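/- Let $(M^n,g)$ be a smooth $n$-dimensional Riemannian manifold (Hausdorff, second countable, without boundary) with Levi-Civita connection $\nabla$ and volume measure $dv_g$, let $u\in C^\infty(M)$, $V=e^u$, let $\lambda,\mu\in\mathbb R$, $\tau=(n+1)\lambda+\mu$, and let $D$ be the affine connection $$D_XY=\nabla_XY+\lambda\,du(X)Y+\lambda\,du(Y)X+\mu\, g(X,Y)\nabla u .$$ Write $\nabla^Df=V^{\mu-\lambda}\nabla f$, $\operatorname{div}^DW=\operatorname{tr}(X\mapsto D_XW)=\operatorname{div}W+\operatorname{tr}(X\mapsto D_XW-\nabla_XW)$ (as a distribution, where $\operatorname{div}W$ is the distribution $\eta\mapsto-\int_M\langle\nabla\eta,W\rangle\,dv_g$), and $\Delta^Df=\operatorname{div}^D(\nabla^Df)$. Let $\rho\ge 0$ be a continuous function on $M$ and put $\Omega=M\setminus\rho^{-1}\{0\}$. Let $\rho$, $a$, $\delta$ be locally Lipschitz on $\Omega$, so that their gradients exist almost everywhere there, with $a\ge0$ and $\delta>0$ on $\Omega$. Let $C>1$ and $\alpha\in\mathbb R$ with $C+\alpha-1>0$. Assume that $$|\nabla^D\rho|=1\quad\text{and}\quad\langle\nabla^Da,\nabla^D\rho\rangle\ge0\quad\text{a.e.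 on }\Omega,$$ and that $$\Delta^D\rho\ge\frac C\rho V^{\lambda-\mu}\quad\text{and}\quad -V^\tau\operatorname{div}^D\!\left(a\rho^{1-C}\nabla^D\delta\right)\ge0$$ on $\Omega$ in the sense of distributions, that is, when paired with every nonnegative $\eta\in C_0^\infty(\Omega)$. Then, for every $\phi\in C_0^\infty(\Omega)$, the four integrals below converge absolutely and $$\begin{aligned}\int_Ma\rho^\alpha|\nabla^D\phi|^2V^{\tau+\lambda-\mu}\,dv_g\ \ge\ &\left(\frac{C+\alpha-1}2\right)^2\int_Ma\rho^{\alpha-2}\phi^2V^{\tau+\lambda-\mu}\,dv_g\\&+\frac{C+\alpha-1}2\int_M\rho^{\alpha-1}\phi^2\langle\nabla^Da,\nabla^D\rho\rangle V^{\tau+\lambda-\mu}\,dv_g\\&+\frac14\int_Ma\rho^\alpha\frac{|\nabla^D\delta|^2}{\delta^2}\phi^2V^{\tau+\lambda-\mu}\,dv_g .\end{aligned}$$ -/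

import Mathlib

open Set MeasureTheory Bundle
open scoped Manifold ContDiff

noncomputable section

namespace AffineHardy

section Riemannian

variable {n : ℕ} {M : Type*} [TopologicalSpace M] [ChartedSpace (EuclideanSpace ℝ (Fin n)) M]

/-- The Riemannian gradient of `f` at `x`: the tangent vector `∇f` with `⟨∇f, v⟩ = df(v)`.
It has the value `0` at the points where `f` is not differentiable. -/
def grad [RiemannianBundle (fun x : M ↦ TangentSpace (𝓡 n) x)] (f : M → ℝ) (x : M) :
    TangentSpace (𝓡 n) x :=
  haveI : FiniteDimensional ℝ (TangentSpace (𝓡 n) x) :=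
    inferInstanceAs (FiniteDimensional ℝ (EuclideanSpace ℝ (Fin n)))
  haveI : CompleteSpace (TangentSpace (𝓡 n) x) := FiniteDimensional.complete ℝ _
  (InnerProductSpace.toDual ℝ (TangentSpace (𝓡 n) x)).symm (mfderiv (𝓡 n) 𝓘(ℝ, ℝ) f x)

/-- The coordinate vector field `∂ᵢ` of the preferred chart at `p`, at the point of `M` with
coordinates `y`. -/
def coordVector (p : M) (y : EuclideanSpace ℝ (Fin n)) (i : Fin n) :
    TangentSpace (𝓡 n) ((extChartAt (𝓡 n) p).symm y) :=
  mfderiv 𝓘(ℝ, EuclideanSpace ℝ (Fin n)) (𝓡 n) (extChartAt (𝓡 n) p).symm y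
    (EuclideanSpace.single i (1 : ℝ))

/-- The matrix `g_{ij} = ⟨∂ᵢ, ∂ⱼ⟩` of the metric in the preferred chart at `p`. -/
def metricMatrix [RiemannianBundle (fun x : M ↦ TangentSpace (𝓡 n) x)]
    (p : M) (y : EuclideanSpace ℝ (Fin n)) : Matrix (Fin n) (Fin n) ℝ :=
  Matrix.of fun i j ↦ inner ℝ (coordVector p y i) (coordVector p y j)

/-- The Riemannian volume on the domain of the preferred chart at `p` (and `0` outside of it):
the measure that reads `√(det g_{ij}) dy` in that chart. -/
def chartVolume [RiemannianBundle (fun x : M ↦ TangentSpace (𝓡 n) x)] [MeasurableSpace M]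
    (p : M) : Measure M :=
  ((volume.restrict (extChartAt (𝓡 n) p).target).withDensity
    fun y ↦ ENNReal.ofReal (Real.sqrt (metricMatrix p y).det)).map (extChartAt (𝓡 n) p).symm

/-- The Riemannian volume measure `dv_g`. The measures `chartVolume p` agree on the overlaps of the
chart domains, by the change of variables formula, so that their supremum is the measure which
coincides with `chartVolume p` on the domain of the chart at `p`, for all `p`. -/
def riemannianVolume (n : ℕ) (M : Type*) [TopologicalSpace M]
    [ChartedSpace (EuclideanSpace ℝ (Fin n)) M]
    [RiemannianBundle (fun x : M ↦ TangentSpace (𝓡 n) x)] [MeasurableSpace M] : Measure M :=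
  ⨆ p : M, chartVolume (n := n) p

/-- `f` is locally Lipschitz on the open set `U`: around each point of `U` it is Lipschitz in the
coordinates of the chart at that point. -/
def LocLipschitzOn (n : ℕ) {M : Type*} [TopologicalSpace M]
    [ChartedSpace (EuclideanSpace ℝ (Fin n)) M] (f : M → ℝ) (U : Set M) : Prop :=
  ∀ p ∈ U, ∃ K : NNReal, ∃ t ∈ nhds (extChartAt (𝓡 n) p p),
    LipschitzOnWith K (f ∘ (extChartAt (𝓡 n) p).symm) t

/-- `η ∈ C₀^∞(U)` : smooth on `M`, with compact support contained in the open set `U`. -/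
structure IsTestFunctionOn (n : ℕ) {M : Type*} [TopologicalSpace M]
    [ChartedSpace (EuclideanSpace ℝ (Fin n)) M] (U : Set M) (η : M → ℝ) : Prop where
  contMDiff : ContMDiff (𝓡 n) 𝓘(ℝ, ℝ) ∞ η
  hasCompactSupport : HasCompactSupport η
  tsupport_subset : tsupport η ⊆ U

/-- A distribution `T` and a function `h` satisfy `T ≥ h` on `U` in the sense of distributions:
`T(η) ≥ ∫ h η dv_g` for all nonnegative test functions `η` on `U`. -/
def DistribGE (n : ℕ) {M : Type*} [TopologicalSpace M]
    [ChartedSpace (EuclideanSpace ℝ (Fin n)) M]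
    [RiemannianBundle (fun x : M ↦ TangentSpace (𝓡 n) x)] [MeasurableSpace M]
    (U : Set M) (T : (M → ℝ) → ℝ) (h : M → ℝ) : Prop :=
  ∀ η : M → ℝ, IsTestFunctionOn n U η → (∀ x, 0 ≤ η x) →
    ∫ x, h x * η x ∂(riemannianVolume n M) ≤ T η

end Riemannian

section Affine

variable {n : ℕ} {M : Type*} [TopologicalSpace M] [ChartedSpace (EuclideanSpace ℝ (Fin n)) M]
  [RiemannianBundle (fun x : M ↦ TangentSpace (𝓡 n) x)]

/-- The difference `X ↦ D_X Y - ∇_X Y` of the affine connection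
`D_X Y = ∇_X Y + λ du(X) Y + λ du(Y) X + μ ⟨X, Y⟩ ∇u` and of the Levi-Civita connection `∇`. -/
def connectionDifference (lam mu : ℝ) (u : M → ℝ) (x : M) (Y : TangentSpace (𝓡 n) x) :
    TangentSpace (𝓡 n) x →ₗ[ℝ] TangentSpace (𝓡 n) x where
  toFun X := (lam * inner ℝ (grad u x) X) • Y + (lam * inner ℝ (grad u x) Y) • X
    + (mu * inner ℝ X Y) • grad u x
  map_add' X X' := by
    simp only [inner_add_left, inner_add_right, mul_add, add_smul, smul_add]; abel
  map_smul' c X := by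
    simp only [inner_smul_left, inner_smul_right, smul_add, smul_smul, RingHom.id_apply,
      conj_trivial]
    congr 2
    · congr 1; ring
    · congr 1; ring
    · ring

/-- The affine gradient `∇^D f = V^{μ - λ} ∇f`, where `V = e^u`. -/
def affineGrad (lam mu : ℝ) (u f : M → ℝ) (x : M) : TangentSpace (𝓡 n) x :=
  (Real.exp (u x)) ^ (mu - lam) • grad f x

/-- The affine divergence `div^D W = tr(X ↦ D_X W) = div W + tr(X ↦ D_X W - ∇_X W)` of a vector
field `W` that need not be differentiable, as a distribution: `div W` acts on test functions by
`η ↦ -∫ ⟨∇η, W⟩ dv_g`, and the trace of the difference tensor is a function. -/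
def affineDiv [MeasurableSpace M] (lam mu : ℝ) (u : M → ℝ)
    (W : (x : M) → TangentSpace (𝓡 n) x) (η : M → ℝ) : ℝ :=
  ∫ x, (- inner ℝ (grad η x) (W x)
    + η x * LinearMap.trace ℝ (TangentSpace (𝓡 n) x) (connectionDifference lam mu u x (W x)))
    ∂(riemannianVolume n M)

/-- The affine Laplacian `Δ^D f = div^D (∇^D f)`, as a distribution. -/
def affineLaplacian (n : ℕ) {M : Type*} [TopologicalSpace M]
    [ChartedSpace (EuclideanSpace ℝ (Fin n)) M]
    [RiemannianBundle (fun x : M ↦ TangentSpace (𝓡 n) x)] [MeasurableSpace M]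
    (lam mu : ℝ) (u f : M → ℝ) (η : M → ℝ) : ℝ :=
  affineDiv (n := n) lam mu u (fun x ↦ affineGrad lam mu u f x) η

end Affine

end AffineHardy

end

/-! The trace of `X ↦ D_X W - ∇_X W` is `τ du(W)`, hence `V^τ div^D W = div(V^τ W)`. With `P =
V^(τ+μ-λ)` and `Q = V^(τ+λ-μ)` one has `|∇^D f|² Q = P |∇f|²`, and the two distributional hypotheses
become the Riemannian inequalities `div(P∇ρ) ≥ (C/ρ) Q` and `-div(a ρ^(1-C) P ∇δ) ≥ 0`
(`affineDiv_exp_rpow_mul`, `weakForm_nonneg_of_affineLaplacian`, `weakForm_nonneg_of_affineDiv`).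
Put `β = (C+α-1)/2` and `h = ρ^(-β) δ^(1/2)`, and expand the nonnegative function `a ρ^α P |∇φ -
φ∇h/h|²`. Modulo `P|∇ρ|² = Q`, which is `|∇^D ρ| = 1`, it equals the integrand on the left of the
Hardy inequality minus the three on the right with their constants, minus `β` times the first weak
integrand tested with `a ρ^(α-1) φ²`, minus `1/2` times the second tested with `ρ^(2β) δ⁻¹ φ²`
(`hardy_pointwise`). Since `β > 0` and both weak integrals are nonnegative, integration gives the
theorem (`hardy_integral`). These two test functions are only locally Lipschitz, whereas the
hypotheses speak of smooth ones. The analytic core is therefore `weakForm_nonneg_of_locLipschitzOn`: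
a partition of unity reduces to one chart, and there mollification preserves sign, upper bounds and
Lipschitz constant while the derivatives converge almost everywhere, so dominated convergence
applies. This needs the volume and the gradients in coordinates, and Rademacher's theorem on `M`. -/

namespace AffineHardy

/-! ### Mollification of Lipschitz functions on Euclidean space. -/

section Euclidean

open Filter Topology
open scoped Convolution

variable {E : Type*} [NormedAddCommGroup E]

/-- A compactly supported locally Lipschitz function on a proper space is Lipschitz. -/
theorem exists_lipschitzWith_of_hasCompactSupport [ProperSpace E] {f : E → ℝ}
    (hf : LocallyLipschitz f) (hc : HasCompactSupport f) : ∃ K, LipschitzWith K f := by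
  -- The unit thickening of the support is compact, so one constant works on it. A point of the
  -- support and a point outside the thickening are at distance at least one, and there the bound
  -- `B` on `|f|` serves as a Lipschitz constant.
  obtain ⟨K, hK⟩ := (hf.locallyLipschitzOn (s := Metric.cthickening 1 (tsupport f))
    ).exists_lipschitzOnWith_of_compact hc.isCompact.cthickening
  obtain ⟨B, hB⟩ := hc.exists_bound_of_continuous hf.continuous
  have hB0 : 0 ≤ B := (norm_nonneg _).trans (hB 0)
  refine ⟨max K B.toNNReal, LipschitzWith.of_dist_le_mul fun x y ↦ ?_⟩
  have key : ∀ x y : E, x ∈ tsupport f →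
      dist (f x) (f y) ≤ max K B.toNNReal * dist x y := by
    intro x y hx
    by_cases hy : y ∈ Metric.cthickening 1 (tsupport f)
    · refine (hK.dist_le_mul x (Metric.self_subset_cthickening _ hx) y hy).trans ?_
      gcongr
      exact le_max_left _ _
    · have h0 : f y = 0 := by
        by_contra h
        exact hy (Metric.self_subset_cthickening _ (subset_tsupport _ h))
      have h1 : 1 ≤ dist x y := by
        by_contra h
        push Not at h
        exact hy (Metric.mem_cthickening_of_dist_le y x 1 _ hx (by rw [dist_comm]; exact h.le))
      calc dist (f x) (f y) ≤ B := by rw [h0, dist_zero_right]; exact hB x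
        _ ≤ B * dist x y := le_mul_of_one_le_right hB0 h1
        _ ≤ _ := by
          gcongr
          exact (Real.le_coe_toNNReal B).trans (NNReal.coe_le_coe.2 (le_max_right _ _))
  by_cases hx : x ∈ tsupport f
  · exact key x y hx
  by_cases hy : y ∈ tsupport f
  · rw [dist_comm, dist_comm x]; exact key y x hy
  · rw [image_eq_zero_of_notMem_tsupport hx, image_eq_zero_of_notMem_tsupport hy, dist_self]
    positivity

variable [NormedSpace ℝ E] [FiniteDimensional ℝ E] [MeasurableSpace E] [BorelSpace E]
  {μ : Measure E} [μ.IsAddHaarMeasure]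

theorem integrable_convolution_integrand (b : ContDiffBump (0 : E)) {f : E → ℝ}
    (hf : Continuous f) (x : E) : Integrable (fun t ↦ b.normed μ t • f (x - t)) μ := by
  refine Continuous.integrable_of_hasCompactSupport ?_ ?_
  · exact b.continuous_normed.smul (hf.comp (continuous_const.sub continuous_id))
  · exact b.hasCompactSupport_normed.smul_right

/-- Mollification does not increase the Lipschitz constant. -/
theorem lipschitzWith_convolution (b : ContDiffBump (0 : E)) {f : E → ℝ} {K : NNReal}
    (hf : LipschitzWith K f) :
    LipschitzWith K (b.normed μ ⋆[ContinuousLinearMap.lsmul ℝ ℝ, μ] f) := by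
  refine LipschitzWith.of_dist_le_mul fun x y ↦ ?_
  simp only [convolution_lsmul]
  rw [dist_eq_norm, ← integral_sub (integrable_convolution_integrand b hf.continuous x)
    (integrable_convolution_integrand b hf.continuous y)]
  refine (norm_integral_le_of_norm_le ((b.integrable_normed (μ := μ)).mul_const (K * dist x y))
    (ae_of_all _ fun t ↦ ?_)).trans_eq ?_
  · rw [← smul_sub, norm_smul, Real.norm_of_nonneg (b.nonneg_normed t)]
    gcongr
    · exact b.nonneg_normed t
    · rw [← dist_eq_norm]
      simpa using hf.dist_le_mul (x - t) (y - t)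
  · rw [integral_mul_const, b.integral_normed, one_mul]

/-- The derivative of a mollified Lipschitz function is the mollified derivative. -/
theorem fderiv_convolution_of_lipschitz (b : ContDiffBump (0 : E)) {f : E → ℝ} {K : NNReal}
    (hf : LipschitzWith K f) (x : E) :
    fderiv ℝ (b.normed μ ⋆[ContinuousLinearMap.lsmul ℝ ℝ, μ] f) x =
      (b.normed μ ⋆[ContinuousLinearMap.lsmul ℝ ℝ, μ] (fderiv ℝ f)) x := by
  have h := hasFDerivAt_integral_of_dominated_loc_of_lip (μ := μ) (𝕜 := ℝ) (s := univ) (x₀ := x)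
    (F := fun x t ↦ b.normed μ t • f (x - t))
    (F' := fun t ↦ b.normed μ t • fderiv ℝ f (x - t)) (bound := fun t ↦ b.normed μ t * K)
    univ_mem
    (Eventually.of_forall fun y ↦
      (integrable_convolution_integrand b hf.continuous y).aestronglyMeasurable)
    (integrable_convolution_integrand b hf.continuous x)
    ?_ (ae_of_all _ fun t ↦ ?_) ((b.integrable_normed (μ := μ)).mul_const _) ?_
  · exact h.2.fderiv
  · exact (b.continuous_normed.aestronglyMeasurable).smul
      ((measurable_fderiv ℝ f).comp (measurable_const.sub measurable_id)).aestronglyMeasurable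
  · refine LipschitzOnWith.of_dist_le_mul fun y _ z _ ↦ ?_
    have : ((b.normed μ t * K).nnabs : ℝ) = b.normed μ t * K := by
      rw [Real.coe_nnabs]; exact abs_of_nonneg (mul_nonneg (b.nonneg_normed t) K.2)
    rw [this, dist_eq_norm, ← smul_sub, norm_smul, Real.norm_of_nonneg (b.nonneg_normed t),
      mul_assoc]
    gcongr
    · exact b.nonneg_normed t
    · rw [← dist_eq_norm]
      simpa using hf.dist_le_mul (y - t) (z - t)
  -- Rademacher's theorem, transported by `t ↦ x - t`, which preserves Haar measure.
  · have h1 : ∀ᵐ t ∂μ, DifferentiableAt ℝ f (x - t) :=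
      (Measure.measurePreserving_sub_left μ x).quasiMeasurePreserving.ae hf.ae_differentiableAt
    filter_upwards [h1] with t ht
    have h2 : HasFDerivAt (fun y ↦ f (y - t)) (fderiv ℝ f (x - t)) x := by
      simpa using! ht.hasFDerivAt.comp x ((hasFDerivAt_id x).sub_const t)
    exact h2.const_smul (b.normed μ t)

/-- A nonnegative Lipschitz function with compact support in an open set `U` is approximated by
smooth functions with the same Lipschitz constant, whose derivatives converge almost everywhere. -/
theorem exists_smooth_approx {f : E → ℝ} {K : NNReal} (hf : LipschitzWith K f)
    (hc : HasCompactSupport f) (h0 : ∀ x, 0 ≤ f x) {U : Set E} (hU : IsOpen U)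
    (hfU : tsupport f ⊆ U) :
    ∃ (g : ℕ → E → ℝ) (S : Set E), IsCompact S ∧ S ⊆ U ∧ (∀ k, ContDiff ℝ ∞ (g k)) ∧
      (∀ k, LipschitzWith K (g k)) ∧ (∀ k, tsupport (g k) ⊆ S) ∧ (∀ k x, 0 ≤ g k x) ∧
      (∀ B, (∀ x, f x ≤ B) → ∀ k x, g k x ≤ B) ∧
      (∀ x, Tendsto (fun k ↦ g k x) atTop (𝓝 (f x))) ∧
      ∀ᵐ x ∂μ, Tendsto (fun k ↦ fderiv ℝ (g k) x) atTop (𝓝 (fderiv ℝ f x)) := by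
  obtain ⟨ε, hε, hεU⟩ := hc.isCompact.exists_cthickening_subset_open hU hfU
  -- The outer radii tend to zero and never exceed `ε`, which keeps the supports in one compact
  -- thickening. The fixed ratio two of the radii is what the almost everywhere convergence below
  -- requires.
  let b : ℕ → ContDiffBump (0 : E) := fun k ↦
    { rIn := ε / (k + 1) / 2
      rOut := ε / (k + 1)
      rIn_pos := by positivity
      rIn_lt_rOut := half_lt_self (by positivity) }
  have hb : Tendsto (fun k ↦ (b k).rOut) atTop (𝓝 0) := by
    have := (tendsto_one_div_add_atTop_nhds_zero_nat (𝕜 := ℝ)).const_mul ε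
    simpa [b, div_eq_mul_inv] using this
  refine ⟨fun k ↦ (b k).normed μ ⋆[ContinuousLinearMap.lsmul ℝ ℝ, μ] f,
    Metric.cthickening ε (tsupport f), hc.isCompact.cthickening, hεU, fun k ↦ ?_,
    fun k ↦ lipschitzWith_convolution (b k) hf, fun k ↦ ?_, fun k x ↦ ?_, fun B hB k x ↦ ?_,
    fun x ↦ ?_, ?_⟩
  · exact (b k).hasCompactSupport_normed.contDiff_convolution_left _ (b k).contDiff_normed
      hf.continuous.locallyIntegrable
  · refine closure_minimal ?_ Metric.isClosed_cthickening
    refine (support_convolution_subset _).trans ?_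
    rintro _ ⟨y, hy, z, hz, rfl⟩
    rw [(b k).support_normed_eq, mem_ball_zero_iff] at hy
    refine Metric.mem_cthickening_of_dist_le _ z ε _ (subset_tsupport _ hz) ?_
    rw [dist_eq_norm, add_sub_cancel_right]
    refine hy.le.trans (div_le_self hε.le ?_)
    linarith [(Nat.cast_nonneg k : (0 : ℝ) ≤ k)]
  · simp only [convolution_lsmul]
    exact integral_nonneg fun t ↦ smul_nonneg ((b k).nonneg_normed t) (h0 _)
  · simp only [convolution_lsmul]
    calc ∫ t, (b k).normed μ t • f (x - t) ∂μ ≤ ∫ t, (b k).normed μ t * B ∂μ :=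
          integral_mono (integrable_convolution_integrand (b k) hf.continuous x)
            (((b k).integrable_normed).mul_const B)
            fun t ↦ mul_le_mul_of_nonneg_left (hB _) ((b k).nonneg_normed t)
      _ = B := by rw [integral_mul_const, (b k).integral_normed, one_mul]
  · exact ContDiffBump.convolution_tendsto_right_of_continuous hb hf.continuous x
  · have hli : LocallyIntegrable (fderiv ℝ f) μ := by
      refine (locallyIntegrable_const (K : ℝ)).mono
        (measurable_fderiv ℝ f).aestronglyMeasurable (ae_of_all _ fun x ↦ ?_)
      exact (norm_fderiv_le_of_lipschitz ℝ hf).trans (Real.le_norm_self _)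
    have h := ContDiffBump.ae_convolution_tendsto_right_of_locallyIntegrable (K := 2) hb
      (Eventually.of_forall fun k ↦ ?_) hli
    · filter_upwards [h] with x hx
      exact hx.congr fun k ↦ (fderiv_convolution_of_lipschitz (b k) hf x).symm
    · change ε / (k + 1) ≤ 2 * (ε / (k + 1) / 2)
      linarith

end Euclidean

/-! ### Coordinate frames and the metric matrix. -/

section Charts

open Filter Topology

variable {n : ℕ} {M : Type*} [TopologicalSpace M] [ChartedSpace (EuclideanSpace ℝ (Fin n)) M]
  [IsManifold (𝓡 n) ∞ M]

theorem mdifferentiableAt_extChartAt_symm {p : M} {y : EuclideanSpace ℝ (Fin n)}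
    (hy : y ∈ (extChartAt (𝓡 n) p).target) :
    MDifferentiableAt 𝓘(ℝ, EuclideanSpace ℝ (Fin n)) (𝓡 n) (extChartAt (𝓡 n) p).symm y := by
  have := mdifferentiableWithinAt_extChartAt_symm (I := 𝓡 n) hy
  rwa [ModelWithCorners.range_eq_univ, mdifferentiableWithinAt_univ] at this

theorem mfderiv_extChartAt_mfderiv_symm {p : M} {y : EuclideanSpace ℝ (Fin n)}
    (hy : y ∈ (extChartAt (𝓡 n) p).target) (v : EuclideanSpace ℝ (Fin n)) :
    mfderiv (𝓡 n) 𝓘(ℝ, EuclideanSpace ℝ (Fin n)) (extChartAt (𝓡 n) p)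
      ((extChartAt (𝓡 n) p).symm y)
      (mfderiv 𝓘(ℝ, EuclideanSpace ℝ (Fin n)) (𝓡 n) (extChartAt (𝓡 n) p).symm y v) = v := by
  have := mfderiv_extChartAt_comp_mfderivWithin_extChartAt_symm (I := 𝓡 n) hy
  rw [ModelWithCorners.range_eq_univ, mfderivWithin_univ] at this
  exact congr($this v)

theorem mfderiv_extChartAt_bijective {p x : M} (hx : x ∈ (extChartAt (𝓡 n) p).source) :
    Function.Bijective (mfderiv (𝓡 n) 𝓘(ℝ, EuclideanSpace ℝ (Fin n)) (extChartAt (𝓡 n) p) x) :=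
  (isInvertible_mfderiv_extChartAt hx).bijective

theorem continuousOn_coordVector (p : M) (i : Fin n) :
    ContinuousOn (fun y ↦ (⟨(extChartAt (𝓡 n) p).symm y, coordVector p y i⟩ :
      TangentBundle (𝓡 n) M)) (extChartAt (𝓡 n) p).target := by
  have h := (contMDiffOn_extChartAt_symm (I := 𝓡 n) (n := ∞) p).continuousOn_tangentMapWithin
    (by simp) (isOpen_extChartAt_target p).uniqueMDiffOn
  have h2 : Continuous (fun y : EuclideanSpace ℝ (Fin n) ↦
      (⟨y, EuclideanSpace.single i (1 : ℝ)⟩ :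
        TangentBundle 𝓘(ℝ, EuclideanSpace ℝ (Fin n)) (EuclideanSpace ℝ (Fin n)))) := by
    have : Continuous (fun y : EuclideanSpace ℝ (Fin n) ↦
      ((tangentBundleModelSpaceHomeomorph 𝓘(ℝ, EuclideanSpace ℝ (Fin n))).symm
        (y, EuclideanSpace.single i (1 : ℝ)))) := by fun_prop
    exact this
  refine (h.comp (s := (extChartAt (𝓡 n) p).target) h2.continuousOn fun y hy ↦ hy).congr
    fun y hy ↦ ?_
  simp only [Function.comp_apply, tangentMapWithin, coordVector]
  rw [mfderivWithin_eq_mfderiv ((isOpen_extChartAt_target p).uniqueMDiffWithinAt hy)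
    (mdifferentiableAt_extChartAt_symm hy)]

variable [RiemannianBundle (fun x : M ↦ TangentSpace (𝓡 n) x)]

/-- Vectors are recognised by their image under the differential of the chart. This allows a frame
based at `x` itself, although `coordVector p y i` is based at the inverse chart image of `y`, which
equals `x` only propositionally. -/
theorem metricMatrix_apply {p x : M} {y : EuclideanSpace ℝ (Fin n)}
    (hy : y ∈ (extChartAt (𝓡 n) p).target) (hx : (extChartAt (𝓡 n) p).symm y = x)
    {v : Fin n → TangentSpace (𝓡 n) x}
    (hv : ∀ i, mfderiv (𝓡 n) 𝓘(ℝ, EuclideanSpace ℝ (Fin n)) (extChartAt (𝓡 n) p) x (v i)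
      = EuclideanSpace.single i (1 : ℝ)) :
    metricMatrix p y = Matrix.gram ℝ v := by
  subst hx
  have : ∀ i, v i = coordVector p y i := fun i ↦
    (mfderiv_extChartAt_bijective ((extChartAt (𝓡 n) p).map_target hy)).1
      ((hv i).trans (mfderiv_extChartAt_mfderiv_symm hy _).symm)
  ext i j
  simp [metricMatrix, Matrix.gram, this]

/-- The differential of the chart sends the coordinate vectors to the standard basis, so they are
independent and their Gram matrix is definite. -/
theorem metricMatrix_posDef {p : M} {y : EuclideanSpace ℝ (Fin n)}
    (hy : y ∈ (extChartAt (𝓡 n) p).target) : (metricMatrix p y).PosDef := by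
  rw [metricMatrix_apply hy rfl (v := fun i ↦ coordVector p y i)
    fun i ↦ mfderiv_extChartAt_mfderiv_symm hy _]
  refine Matrix.posDef_gram_of_linearIndependent ?_
  refine LinearIndependent.of_comp (mfderiv (𝓡 n) 𝓘(ℝ, EuclideanSpace ℝ (Fin n))
    (extChartAt (𝓡 n) p) ((extChartAt (𝓡 n) p).symm y)).toLinearMap ?_
  have h := (EuclideanSpace.basisFun (Fin n) ℝ).toBasis.linearIndependent
  convert! h using 1
  ext1 i
  simp only [Function.comp_apply, OrthonormalBasis.coe_toBasis, EuclideanSpace.basisFun_apply]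
  exact mfderiv_extChartAt_mfderiv_symm hy _

theorem continuousOn_metricMatrix [IsContinuousRiemannianBundle (EuclideanSpace ℝ (Fin n))
      (fun x : M ↦ TangentSpace (𝓡 n) x)] (p : M) :
    ContinuousOn (metricMatrix (n := n) p) (extChartAt (𝓡 n) p).target := by
  refine continuousOn_pi.2 fun i ↦ continuousOn_pi.2 fun j ↦ ?_
  exact ContinuousOn.inner_bundle (F := EuclideanSpace ℝ (Fin n))
    (E := fun x : M ↦ TangentSpace (𝓡 n) x)
    (continuousOn_coordVector p i) (continuousOn_coordVector p j)

/-- The transformation of the volume density under a change of charts. -/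
theorem sqrt_det_metricMatrix_transition {p q : M} {y : EuclideanSpace ℝ (Fin n)}
    (hy : y ∈ (extChartAt (𝓡 n) p).target)
    (hyq : (extChartAt (𝓡 n) p).symm y ∈ (extChartAt (𝓡 n) q).source) :
    DifferentiableAt ℝ (extChartAt (𝓡 n) q ∘ (extChartAt (𝓡 n) p).symm) y ∧
    Real.sqrt (metricMatrix p y).det =
      |(fderiv ℝ (extChartAt (𝓡 n) q ∘ (extChartAt (𝓡 n) p).symm) y).det| *
        Real.sqrt (metricMatrix q
          (extChartAt (𝓡 n) q ((extChartAt (𝓡 n) p).symm y))).det := by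
  set x := (extChartAt (𝓡 n) p).symm y with hx
  set J := fderiv ℝ (extChartAt (𝓡 n) q ∘ (extChartAt (𝓡 n) p).symm) y with hJ
  have hdq : MDifferentiableAt (𝓡 n) 𝓘(ℝ, EuclideanSpace ℝ (Fin n)) (extChartAt (𝓡 n) q) x :=
    mdifferentiableAt_extChartAt (by rwa [← extChartAt_source (I := 𝓡 n)])
  have hds := mdifferentiableAt_extChartAt_symm hy
  refine ⟨(hdq.comp y hds).differentiableAt, ?_⟩
  have hJv : ∀ v, J v = mfderiv (𝓡 n) 𝓘(ℝ, EuclideanSpace ℝ (Fin n)) (extChartAt (𝓡 n) q) x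
      (mfderiv 𝓘(ℝ, EuclideanSpace ℝ (Fin n)) (𝓡 n) (extChartAt (𝓡 n) p).symm y v) := by
    intro v
    have := mfderiv_comp y hdq hds
    rw [mfderiv_eq_fderiv] at this
    exact congr($this v)
  have hbij := mfderiv_extChartAt_bijective hyq
  -- `w` is the frame of the chart at `q`. The frame of the chart at `p` has the Jacobian `A` as its
  -- coefficients in `w`, whence `G_p = Aᵀ G_q A`; determinants and square roots follow.
  choose w hw using fun i : Fin n ↦ hbij.2 (EuclideanSpace.single i (1 : ℝ))
  have hp : metricMatrix p y = Matrix.gram ℝ (fun i ↦ coordVector p y i) :=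
    metricMatrix_apply hy rfl fun i ↦ mfderiv_extChartAt_mfderiv_symm hy _
  have hq : metricMatrix q (extChartAt (𝓡 n) q x) = Matrix.gram ℝ w :=
    metricMatrix_apply ((extChartAt (𝓡 n) q).map_source hyq)
      ((extChartAt (𝓡 n) q).left_inv hyq) hw
  set A : Matrix (Fin n) (Fin n) ℝ := LinearMap.toMatrix
    (EuclideanSpace.basisFun (Fin n) ℝ).toBasis (EuclideanSpace.basisFun (Fin n) ℝ).toBasis
    (J : EuclideanSpace ℝ (Fin n) →ₗ[ℝ] EuclideanSpace ℝ (Fin n)) with hA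
  have hAJ : A.det = J.det := LinearMap.det_toMatrix _ _
  have hAik : ∀ k i, A k i = J (EuclideanSpace.single i 1) k := by
    intro k i
    simp [hA, LinearMap.toMatrix_apply]
  have hv : ∀ i, coordVector p y i = ∑ k, A k i • w k := by
    intro i
    apply hbij.1
    rw [map_sum]
    simp only [map_smul, hw]
    refine (hJv _).symm.trans ?_
    simp only [hAik]
    have hsum : ∀ v : EuclideanSpace ℝ (Fin n), v = ∑ k, v k • EuclideanSpace.single k (1 : ℝ) := by
      intro v
      simpa using ((EuclideanSpace.basisFun (Fin n) ℝ).sum_repr v).symm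
    exact hsum _
  have hgram : Matrix.gram ℝ (fun i ↦ coordVector p y i) = A.transpose * Matrix.gram ℝ w * A := by
    ext i j
    simp only [Matrix.gram, Matrix.of_apply, hv, Matrix.mul_apply, Matrix.transpose_apply,
      sum_inner, inner_sum, inner_smul_left, inner_smul_right, conj_trivial, Finset.sum_mul,
      Finset.mul_sum]
    refine Finset.sum_congr rfl fun k _ ↦ Finset.sum_congr rfl fun l _ ↦ ?_
    ring
  rw [hp, hq, hgram, Matrix.det_mul, Matrix.det_mul, Matrix.det_transpose, hAJ,
    mul_right_comm, ← sq, Real.sqrt_mul (sq_nonneg _), Real.sqrt_sq_eq_abs]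

end Charts

/-! ### The Riemannian volume computed in charts. -/

section Volume

open Filter Topology

theorem measurableSet_inter_preimage_of_continuousOn {X Y : Type*} [TopologicalSpace X]
    [MeasurableSpace X] [OpensMeasurableSpace X] [TopologicalSpace Y] [MeasurableSpace Y]
    [BorelSpace Y] {f : X → Y} {s : Set X} (hf : ContinuousOn f s) (hs : MeasurableSet s)
    {A : Set Y} (hA : MeasurableSet A) : MeasurableSet (s ∩ f ⁻¹' A) := by
  have h : MeasurableSet ((fun x : s ↦ f x) ⁻¹' A) :=
    (continuousOn_iff_continuous_domRestrict.1 hf).measurable hA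
  convert hs.subtype_image h using 1
  ext x
  simp [and_comm]

variable {n : ℕ} {M : Type*} [TopologicalSpace M] [ChartedSpace (EuclideanSpace ℝ (Fin n)) M]

section

variable [MeasurableSpace M] [BorelSpace M]

theorem aemeasurable_extChartAt_symm (p : M) :
    AEMeasurable (extChartAt (𝓡 n) p).symm
      (volume.restrict (extChartAt (𝓡 n) p).target) :=
  (continuousOn_extChartAt_symm p).aemeasurable (isOpen_extChartAt_target p).measurableSet

theorem measurableSet_image_extChartAt {p : M} {A : Set M} (hA : MeasurableSet A)
    (hAp : A ⊆ (extChartAt (𝓡 n) p).source) : MeasurableSet (extChartAt (𝓡 n) p '' A) := by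
  have h : extChartAt (𝓡 n) p '' A =
      (extChartAt (𝓡 n) p).target ∩ (extChartAt (𝓡 n) p).symm ⁻¹' A :=
    (extChartAt (𝓡 n) p).image_eq_target_inter_inv_preimage hAp
  rw [h]
  exact measurableSet_inter_preimage_of_continuousOn (continuousOn_extChartAt_symm p)
    (isOpen_extChartAt_target p).measurableSet hA

variable [RiemannianBundle (fun x : M ↦ TangentSpace (𝓡 n) x)]

theorem chartVolume_apply (p : M) {A : Set M} (hA : MeasurableSet A) :
    chartVolume (n := n) p A = ∫⁻ y in (extChartAt (𝓡 n) p).target ∩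
      (extChartAt (𝓡 n) p).symm ⁻¹' A, ENNReal.ofReal (Real.sqrt (metricMatrix p y).det) := by
  have hs := measurableSet_inter_preimage_of_continuousOn (continuousOn_extChartAt_symm p)
    (isOpen_extChartAt_target (I := 𝓡 n) p).measurableSet hA
  have hm := aemeasurable_extChartAt_symm (n := n) p
  have hnull := hm.nullMeasurable hA
  rw [chartVolume, Measure.map_apply_of_aemeasurable
    (hm.mono_ac (withDensity_absolutelyContinuous _ _)) hA, withDensity_apply₀ _ hnull,
    Measure.restrict_restrict₀ hnull, inter_comm]

theorem chartVolume_inter_source (p : M) {A : Set M} (hA : MeasurableSet A) :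
    chartVolume (n := n) p A = chartVolume (n := n) p (A ∩ (extChartAt (𝓡 n) p).source) := by
  rw [chartVolume_apply p hA, chartVolume_apply p
    (hA.inter (isOpen_extChartAt_source p).measurableSet)]
  congr 2
  ext y
  constructor
  · exact fun h ↦ ⟨h.1, h.2, (extChartAt (𝓡 n) p).map_target h.1⟩
  · exact fun h ↦ ⟨h.1, h.2.1⟩

theorem chartVolume_apply_of_subset {p : M} {A : Set M} (hA : MeasurableSet A)
    (hAp : A ⊆ (extChartAt (𝓡 n) p).source) :
    chartVolume (n := n) p A = ∫⁻ y in extChartAt (𝓡 n) p '' A,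
      ENNReal.ofReal (Real.sqrt (metricMatrix p y).det) := by
  rw [chartVolume_apply p hA, (extChartAt (𝓡 n) p).image_eq_target_inter_inv_preimage hAp]

variable [IsManifold (𝓡 n) ∞ M]

/-- The measures `chartVolume p` agree on the overlaps of the chart domains. -/
theorem chartVolume_eq_chartVolume {p q : M} {A : Set M} (hA : MeasurableSet A)
    (hAp : A ⊆ (extChartAt (𝓡 n) p).source) (hAq : A ⊆ (extChartAt (𝓡 n) q).source) :
    chartVolume (n := n) p A = chartVolume (n := n) q A := by
  rw [chartVolume_apply_of_subset hA hAp, chartVolume_apply_of_subset hA hAq]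
  have himg : extChartAt (𝓡 n) q '' A =
      (extChartAt (𝓡 n) q ∘ (extChartAt (𝓡 n) p).symm) '' (extChartAt (𝓡 n) p '' A) := by
    rw [image_image]
    refine image_congr fun x hx ↦ ?_
    rw [Function.comp_apply, (extChartAt (𝓡 n) p).left_inv (hAp hx)]
  have hmem : ∀ y ∈ extChartAt (𝓡 n) p '' A, y ∈ (extChartAt (𝓡 n) p).target ∧
      (extChartAt (𝓡 n) p).symm y ∈ A := by
    rintro _ ⟨x, hx, rfl⟩
    refine ⟨(extChartAt (𝓡 n) p).map_source (hAp hx), ?_⟩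
    rwa [(extChartAt (𝓡 n) p).left_inv (hAp hx)]
  -- Change of variables along the injective transition map; its Jacobian is exactly the ratio of
  -- the two densities.
  rw [himg, lintegral_image_eq_lintegral_abs_det_fderiv_mul volume
    (measurableSet_image_extChartAt hA hAp)
    (fun y hy ↦ (sqrt_det_metricMatrix_transition (hmem y hy).1
      (hAq (hmem y hy).2)).1.hasFDerivAt.hasFDerivWithinAt)]
  · refine setLIntegral_congr_fun (measurableSet_image_extChartAt hA hAp) fun y hy ↦ ?_
    rw [← ENNReal.ofReal_mul (abs_nonneg _), (sqrt_det_metricMatrix_transition (hmem y hy).1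
      (hAq (hmem y hy).2)).2]
    rfl
  · rintro y hy z hz h
    have h2 := (extChartAt (𝓡 n) q).injOn (hAq (hmem y hy).2) (hAq (hmem z hz).2) h
    exact (extChartAt (𝓡 n) p).symm.injOn (hmem y hy).1 (hmem z hz).1 h2

variable [SecondCountableTopology M]

/-- The Riemannian volume of a set in a chart domain is computed in that chart. -/
theorem riemannianVolume_apply {p : M} {A : Set M} (hA : MeasurableSet A)
    (hAp : A ⊆ (extChartAt (𝓡 n) p).source) :
    riemannianVolume n M A = ∫⁻ y in extChartAt (𝓡 n) p '' A,
      ENNReal.ofReal (Real.sqrt (metricMatrix p y).det) := by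
  rw [← chartVolume_apply_of_subset hA hAp]
  refine le_antisymm ?_ (Measure.le_iff'.1 (le_iSup (fun p : M ↦ chartVolume (n := n) p) p) A)
  obtain ⟨T, hT, hTu⟩ := TopologicalSpace.countable_cover_nhds
    (f := fun p : M ↦ (extChartAt (𝓡 n) p).source) fun p ↦ extChartAt_source_mem_nhds p
  have hTne : T.Nonempty := by
    by_contra h
    rw [not_nonempty_iff_eq_empty] at h
    subst h
    rw [biUnion_empty] at hTu
    exact absurd (hTu.symm ▸ mem_univ p : p ∈ (∅ : Set M)) (notMem_empty p)
  obtain ⟨c, rfl⟩ := hT.exists_eq_range hTne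
  rw [biUnion_range] at hTu
  set D := disjointed fun i ↦ (extChartAt (𝓡 n) (c i)).source with hD
  have hDm : ∀ i, MeasurableSet (D i) := fun i ↦
    MeasurableSet.disjointed (fun j ↦ (isOpen_extChartAt_source (c j)).measurableSet) i
  have hDs : ∀ i, D i ⊆ (extChartAt (𝓡 n) (c i)).source := fun i ↦ disjointed_subset _ i
  have hsum : ∀ q : M, Measure.sum (fun i ↦ (chartVolume (n := n) q).restrict (D i)) =
      chartVolume (n := n) q := by
    intro q
    rw [← Measure.restrict_iUnion (disjoint_disjointed _) hDm, iUnion_disjointed, hTu,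
      Measure.restrict_univ]
  -- The countable cover is cut into disjoint pieces `D i`, and the measure given on `D i` by the
  -- chart at `c i` is a single upper bound for all chart volumes, hence for their supremum. Inside
  -- the chart at `p` it agrees with `chartVolume p`.
  have hle : riemannianVolume n M ≤
      Measure.sum (fun i ↦ (chartVolume (n := n) (c i)).restrict (D i)) := by
    refine iSup_le fun q ↦ Measure.le_iff.2 fun B hB ↦ ?_
    rw [← hsum q, Measure.sum_apply _ hB, Measure.sum_apply _ hB]
    refine ENNReal.tsum_le_tsum fun i ↦ ?_
    rw [Measure.restrict_apply hB, Measure.restrict_apply hB,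
      chartVolume_inter_source q (hB.inter (hDm i)),
      chartVolume_eq_chartVolume (q := c i)
        ((hB.inter (hDm i)).inter (isOpen_extChartAt_source q).measurableSet)
        inter_subset_right ((inter_subset_left.trans inter_subset_right).trans (hDs i))]
    exact measure_mono inter_subset_left
  refine (Measure.le_iff'.1 hle A).trans_eq ?_
  conv_rhs => rw [← hsum p]
  rw [Measure.sum_apply _ hA, Measure.sum_apply _ hA]
  refine tsum_congr fun i ↦ ?_
  rw [Measure.restrict_apply hA, Measure.restrict_apply hA]
  exact chartVolume_eq_chartVolume (hA.inter (hDm i))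
    (inter_subset_right.trans (hDs i)) (inter_subset_left.trans hAp)

/-- Properties valid almost everywhere in a chart are valid almost everywhere for the volume. -/
theorem ae_of_ae_chart {p : M} {P : M → Prop}
    (h : ∀ᵐ y ∂(volume : Measure (EuclideanSpace ℝ (Fin n))),
      y ∈ (extChartAt (𝓡 n) p).target → P ((extChartAt (𝓡 n) p).symm y)) :
    ∀ᵐ x ∂(riemannianVolume n M), x ∈ (extChartAt (𝓡 n) p).source → P x := by
  -- The exceptional set need not be measurable; a measurable null superset makes its preimage under
  -- the chart measurable.
  set N := toMeasurable volume {y : EuclideanSpace ℝ (Fin n) |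
    ¬ (y ∈ (extChartAt (𝓡 n) p).target → P ((extChartAt (𝓡 n) p).symm y))} with hN
  have hN0 : volume N = 0 := by rw [hN, measure_toMeasurable]; exact h
  have hm : MeasurableSet ((extChartAt (𝓡 n) p).source ∩ extChartAt (𝓡 n) p ⁻¹' N) :=
    measurableSet_inter_preimage_of_continuousOn (continuousOn_extChartAt p)
      (isOpen_extChartAt_source p).measurableSet (measurableSet_toMeasurable _ _)
  refine measure_mono_null (t := (extChartAt (𝓡 n) p).source ∩ extChartAt (𝓡 n) p ⁻¹' N) ?_ ?_
  · intro x hx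
    have hx' : ¬ (x ∈ (extChartAt (𝓡 n) p).source → P x) := hx
    push Not at hx'
    refine ⟨hx'.1, subset_toMeasurable _ _ ?_⟩
    simp only [mem_ofPred_eq]
    push Not
    refine ⟨(extChartAt (𝓡 n) p).map_source hx'.1, ?_⟩
    rw [(extChartAt (𝓡 n) p).left_inv hx'.1]
    exact hx'.2
  · rw [riemannianVolume_apply hm inter_subset_left]
    refine setLIntegral_measure_zero _ _ (measure_mono_null ?_ hN0)
    rintro _ ⟨x, hx, rfl⟩
    exact hx.2

/-- A function with a measurable coordinate expression is measurable on the chart domain. -/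
theorem aestronglyMeasurable_of_chart {p : M} {f : M → ℝ} {g : EuclideanSpace ℝ (Fin n) → ℝ}
    (hg : AEMeasurable g (volume.restrict (extChartAt (𝓡 n) p).target))
    (h : ∀ y ∈ (extChartAt (𝓡 n) p).target, f ((extChartAt (𝓡 n) p).symm y) = g y) :
    AEStronglyMeasurable f ((riemannianVolume n M).restrict (extChartAt (𝓡 n) p).source) := by
  have hs := (isOpen_extChartAt_source (I := 𝓡 n) p).measurableSet
  have h1 : AEMeasurable (extChartAt (𝓡 n) p)
      ((riemannianVolume n M).restrict (extChartAt (𝓡 n) p).source) :=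
    (continuousOn_extChartAt p).aemeasurable hs
  refine ((hg.measurable_mk.comp_aemeasurable h1).congr ?_).aestronglyMeasurable
  refine (ae_restrict_iff' hs).2 ?_
  refine ae_of_ae_chart (P := fun x ↦ (hg.mk g ∘ extChartAt (𝓡 n) p) x = f x) ?_
  have h2 := (ae_restrict_iff' (isOpen_extChartAt_target p).measurableSet).1 hg.ae_eq_mk
  filter_upwards [h2] with y hy hyt
  rw [h y hyt, hy hyt, Function.comp_apply, (extChartAt (𝓡 n) p).right_inv hyt]

variable [IsContMDiffRiemannianBundle (𝓡 n) ∞ (EuclideanSpace ℝ (Fin n))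
      (fun x : M ↦ TangentSpace (𝓡 n) x)]

/-- The tangent bundle of a smooth Riemannian manifold is a continuous Riemannian bundle. -/
instance isContinuousRiemannianBundle_tangent :
    IsContinuousRiemannianBundle (EuclideanSpace ℝ (Fin n))
      (fun x : M ↦ TangentSpace (𝓡 n) x) := by
  obtain ⟨g, hg, h⟩ := ‹IsContMDiffRiemannianBundle (𝓡 n) ∞ (EuclideanSpace ℝ (Fin n))
      (fun x : M ↦ TangentSpace (𝓡 n) x)›.exists_contMDiff
  exact ⟨⟨g, hg.continuous, h⟩⟩

/-- The density is continuous on the chart target, hence integrable on a compact coordinate ball. -/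
instance isLocallyFiniteMeasure_riemannianVolume :
    IsLocallyFiniteMeasure (riemannianVolume n M) := by
  refine ⟨fun p ↦ ?_⟩
  obtain ⟨r, hr, hrt⟩ := Metric.nhds_basis_closedBall.mem_iff.1
    (extChartAt_target_mem_nhds (I := 𝓡 n) p)
  have hm : MeasurableSet ((extChartAt (𝓡 n) p).source ∩
      extChartAt (𝓡 n) p ⁻¹' Metric.closedBall (extChartAt (𝓡 n) p p) r) :=
    measurableSet_inter_preimage_of_continuousOn (continuousOn_extChartAt p)
      (isOpen_extChartAt_source p).measurableSet Metric.isClosed_closedBall.measurableSet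
  refine ⟨(extChartAt (𝓡 n) p).source ∩
      extChartAt (𝓡 n) p ⁻¹' Metric.closedBall (extChartAt (𝓡 n) p p) r, Filter.inter_mem (extChartAt_source_mem_nhds p)
    ((continuousAt_extChartAt p).preimage_mem_nhds (Metric.closedBall_mem_nhds _ hr)), ?_⟩
  rw [riemannianVolume_apply hm inter_subset_left]
  have hc : ContinuousOn (fun y ↦ Real.sqrt (metricMatrix p y).det)
      (Metric.closedBall (extChartAt (𝓡 n) p p) r) :=
    (Real.continuous_sqrt.comp_continuousOn <|
      (Continuous.matrix_det continuous_id).comp_continuousOn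
        (continuousOn_metricMatrix p)).mono hrt
  have hi := hc.integrableOn_compact (μ := volume) (isCompact_closedBall _ _)
  refine (lintegral_mono_set ?_).trans_lt hi.lintegral_lt_top
  rintro _ ⟨x, hx, rfl⟩
  exact hx.2

end

end Volume

/-! ### Locally Lipschitz functions and Rademacher's theorem on the manifold. -/

section LocallyLipschitz

open Filter Topology

variable {n : ℕ} {M : Type*} [TopologicalSpace M] [ChartedSpace (EuclideanSpace ℝ (Fin n)) M]
  {f h : M → ℝ} {U : Set M}

theorem eventually_symm_extChartAt_mem {p x : M} (hx : x ∈ (extChartAt (𝓡 n) p).source)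
    {N : Set M} (hN : N ∈ 𝓝 x) :
    ∀ᶠ y in 𝓝 (extChartAt (𝓡 n) p x), (extChartAt (𝓡 n) p).symm y ∈ N := by
  have h1 := continuousAt_extChartAt_symm' (I := 𝓡 n) hx
  rw [ContinuousAt, (extChartAt (𝓡 n) p).left_inv hx] at h1
  exact h1 hN

theorem LocLipschitzOn.continuousAt (hf : LocLipschitzOn n f U) {p : M} (hp : p ∈ U) :
    ContinuousAt f p := by
  obtain ⟨K, t, ht, hK⟩ := hf p hp
  have h1 : ContinuousAt (f ∘ (extChartAt (𝓡 n) p).symm) (extChartAt (𝓡 n) p p) :=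
    hK.continuousOn.continuousAt ht
  refine (ContinuousAt.comp h1 (continuousAt_extChartAt p)).congr ?_
  filter_upwards [extChartAt_source_mem_nhds (I := 𝓡 n) p] with x hx
  simp only [Function.comp_apply, (extChartAt (𝓡 n) p).left_inv hx]

theorem LocLipschitzOn.continuousOn (hf : LocLipschitzOn n f U) : ContinuousOn f U :=
  fun _ hp ↦ (hf.continuousAt hp).continuousWithinAt

theorem LocLipschitzOn.comp {F : ℝ → ℝ} (hf : LocLipschitzOn n f U)
    (hF : ∀ x ∈ U, ContDiffAt ℝ 1 F (f x)) : LocLipschitzOn n (fun x ↦ F (f x)) U := by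
  intro p hp
  obtain ⟨K, t, ht, hK⟩ := hf p hp
  obtain ⟨L, s, hs, hL⟩ := (hF p hp).exists_lipschitzOnWith
  have h1 := hK.continuousOn.continuousAt ht
  have hs' : s ∈ 𝓝 ((f ∘ (extChartAt (𝓡 n) p).symm) (extChartAt (𝓡 n) p p)) := by
    simpa using hs
  refine ⟨L * K, t ∩ (f ∘ (extChartAt (𝓡 n) p).symm) ⁻¹' s, inter_mem ht (h1 hs'), ?_⟩
  exact hL.comp (hK.mono inter_subset_left) fun y hy ↦ hy.2

theorem LocLipschitzOn.mul (hf : LocLipschitzOn n f U) (hh : LocLipschitzOn n h U) :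
    LocLipschitzOn n (fun x ↦ f x * h x) U := by
  intro p hp
  obtain ⟨K, t, ht, hK⟩ := hf p hp
  obtain ⟨K', t', ht', hK'⟩ := hh p hp
  have hF : ContDiffAt ℝ 1 (fun z : ℝ × ℝ ↦ z.1 * z.2) (f p, h p) :=
    (contDiff_fst.mul contDiff_snd).contDiffAt
  obtain ⟨L, s, hs, hL⟩ := hF.exists_lipschitzOnWith
  have h2 := (hK.mono (inter_subset_left (t := t'))).prodMk (hK'.mono (inter_subset_right (s := t)))
  have h1 := h2.continuousOn.continuousAt (inter_mem ht ht')
  have hs' : s ∈ 𝓝 ((f ∘ (extChartAt (𝓡 n) p).symm) (extChartAt (𝓡 n) p p),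
      (h ∘ (extChartAt (𝓡 n) p).symm) (extChartAt (𝓡 n) p p)) := by
    simpa using hs
  exact ⟨_, _, inter_mem (inter_mem ht ht') (h1 hs'),
    hL.comp (h2.mono inter_subset_left) fun y hy ↦ hy.2⟩

theorem mdifferentiableAt_of_chart [IsManifold (𝓡 n) ∞ M] {p x : M}
    (hx : x ∈ (extChartAt (𝓡 n) p).source)
    (hd : DifferentiableAt ℝ (f ∘ (extChartAt (𝓡 n) p).symm) (extChartAt (𝓡 n) p x)) :
    MDifferentiableAt (𝓡 n) 𝓘(ℝ, ℝ) f x := by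
  have h1 : MDifferentiableAt (𝓡 n) 𝓘(ℝ, EuclideanSpace ℝ (Fin n)) (extChartAt (𝓡 n) p) x :=
    mdifferentiableAt_extChartAt (by rwa [← extChartAt_source (I := 𝓡 n)])
  refine (hd.mdifferentiableAt.comp x h1).congr_of_eventuallyEq ?_
  filter_upwards [(isOpen_extChartAt_source (I := 𝓡 n) p).mem_nhds hx] with z hz
  simp only [Function.comp_apply, (extChartAt (𝓡 n) p).left_inv hz]

theorem hasFDerivAt_comp_extChartAt_symm [IsManifold (𝓡 n) ∞ M] {p : M}
    {y : EuclideanSpace ℝ (Fin n)} (hy : y ∈ (extChartAt (𝓡 n) p).target)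
    (hd : MDifferentiableAt (𝓡 n) 𝓘(ℝ, ℝ) f ((extChartAt (𝓡 n) p).symm y)) :
    DifferentiableAt ℝ (f ∘ (extChartAt (𝓡 n) p).symm) y ∧
    ∀ v : EuclideanSpace ℝ (Fin n), fderiv ℝ (f ∘ (extChartAt (𝓡 n) p).symm) y v =
      mfderiv (𝓡 n) 𝓘(ℝ, ℝ) f ((extChartAt (𝓡 n) p).symm y)
        (mfderiv 𝓘(ℝ, EuclideanSpace ℝ (Fin n)) (𝓡 n) (extChartAt (𝓡 n) p).symm y v) := by
  have hds := mdifferentiableAt_extChartAt_symm hy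
  refine ⟨(hd.comp y hds).differentiableAt, fun v ↦ ?_⟩
  have := mfderiv_comp y hd hds
  rw [mfderiv_eq_fderiv] at this
  exact congr($this v)

/-- A locally Lipschitz function is locally Lipschitz in every chart. -/
theorem LocLipschitzOn.exists_lipschitzOnWith_chart [IsManifold (𝓡 n) ∞ M]
    (hf : LocLipschitzOn n f U) {p q : M} (hq : q ∈ U) (hqp : q ∈ (extChartAt (𝓡 n) p).source) :
    ∃ K : NNReal, ∃ t ∈ 𝓝 (extChartAt (𝓡 n) p q),
      LipschitzOnWith K (f ∘ (extChartAt (𝓡 n) p).symm) t := by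
  obtain ⟨K, t, ht, hK⟩ := hf q hq
  have h1 : ContMDiffAt 𝓘(ℝ, EuclideanSpace ℝ (Fin n)) (𝓡 n) 1 (extChartAt (𝓡 n) p).symm
      (extChartAt (𝓡 n) p q) :=
    (contMDiffOn_extChartAt_symm p).contMDiffAt
      ((isOpen_extChartAt_target p).mem_nhds ((extChartAt (𝓡 n) p).map_source hqp))
  have h2 : ContMDiffAt (𝓡 n) 𝓘(ℝ, EuclideanSpace ℝ (Fin n)) 1 (extChartAt (𝓡 n) q)
      ((extChartAt (𝓡 n) p).symm (extChartAt (𝓡 n) p q)) := by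
    rw [(extChartAt (𝓡 n) p).left_inv hqp]
    exact contMDiffAt_extChartAt
  have h3 := (h2.comp _ h1).contDiffAt
  obtain ⟨L, s, hs, hL⟩ := h3.exists_lipschitzOnWith
  have h4 := h3.continuousAt
  have ht' : t ∈ 𝓝 ((extChartAt (𝓡 n) q ∘ (extChartAt (𝓡 n) p).symm)
      (extChartAt (𝓡 n) p q)) := by
    rwa [Function.comp_apply, (extChartAt (𝓡 n) p).left_inv hqp]
  refine ⟨K * L, _, inter_mem (inter_mem hs (h4 ht')) (eventually_symm_extChartAt_mem hqp
    (extChartAt_source_mem_nhds (I := 𝓡 n) q)), ?_⟩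
  intro y hy z hz
  have h5 := (hK.comp (hL.mono (inter_subset_left.trans inter_subset_left))
    fun y hy ↦ hy.1.2) hy hz
  simp only [Function.comp_apply] at h5 ⊢
  rwa [(extChartAt (𝓡 n) q).left_inv hy.2, (extChartAt (𝓡 n) q).left_inv hz.2] at h5

theorem locLipschitzOn_of_contMDiff [IsManifold (𝓡 n) ∞ M]
    (hf : ContMDiff (𝓡 n) 𝓘(ℝ, ℝ) ∞ f) (U : Set M) : LocLipschitzOn n f U := by
  intro p _
  have h1 : ContMDiffAt 𝓘(ℝ, EuclideanSpace ℝ (Fin n)) (𝓡 n) 1 (extChartAt (𝓡 n) p).symm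
      (extChartAt (𝓡 n) p p) :=
    (contMDiffOn_extChartAt_symm p).contMDiffAt (extChartAt_target_mem_nhds p)
  have h2 : ContMDiff (𝓡 n) 𝓘(ℝ, ℝ) 1 f := hf.of_le (by simp)
  exact ((h2 _).comp _ h1).contDiffAt.exists_lipschitzOnWith

/-- Rademacher's theorem on a Riemannian manifold. -/
theorem LocLipschitzOn.ae_mdifferentiableAt [IsManifold (𝓡 n) ∞ M] [SecondCountableTopology M]
    [MeasurableSpace M] [BorelSpace M] [RiemannianBundle (fun x : M ↦ TangentSpace (𝓡 n) x)]
    (hf : LocLipschitzOn n f U) :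
    ∀ᵐ x ∂(riemannianVolume n M), x ∈ U → MDifferentiableAt (𝓡 n) 𝓘(ℝ, ℝ) f x := by
  -- By second countability it suffices that the exceptional set is null near each of its points,
  -- where the Euclidean theorem applies in the chart at that point.
  refine measure_null_of_locally_null _ fun p hp ↦ ?_
  have hpU : p ∈ U := by
    have : ¬ (p ∈ U → MDifferentiableAt (𝓡 n) 𝓘(ℝ, ℝ) f p) := hp
    push Not at this
    exact this.1
  obtain ⟨K, t, ht, hK⟩ := hf p hpU
  obtain ⟨s, hst, hs, hps⟩ := mem_nhds_iff.1 ht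
  have h1 := ((hK.mono hst).ae_differentiableWithinAt_of_mem (μ := volume))
  have h2 := ae_of_ae_chart (n := n) (p := p) (P := fun x ↦ extChartAt (𝓡 n) p x ∈ s →
    MDifferentiableAt (𝓡 n) 𝓘(ℝ, ℝ) f x) (by
      filter_upwards [h1] with y hy hyt hys
      rw [(extChartAt (𝓡 n) p).right_inv hyt] at hys
      refine mdifferentiableAt_of_chart ((extChartAt (𝓡 n) p).map_target hyt) ?_
      rw [(extChartAt (𝓡 n) p).right_inv hyt]
      exact (hy hys).differentiableAt (hs.mem_nhds hys))
  refine ⟨_, mem_nhdsWithin_of_mem_nhds (inter_mem (extChartAt_source_mem_nhds (I := 𝓡 n) p)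
    ((continuousAt_extChartAt (I := 𝓡 n) p).preimage_mem_nhds (hs.mem_nhds hps))) |>
      inter_mem self_mem_nhdsWithin, ?_⟩
  refine measure_mono_null ?_ h2
  rintro x ⟨hx, hxp, hxs⟩
  have hx' : ¬ (x ∈ U → MDifferentiableAt (𝓡 n) 𝓘(ℝ, ℝ) f x) := hx
  intro h
  exact hx' fun _ ↦ h hxp hxs

end LocallyLipschitz

/-! ### Calculus, coordinate formula, bounds and integrability of gradients. -/

section Gradient

open Filter Topology

variable {n : ℕ} {M : Type*} [TopologicalSpace M] [ChartedSpace (EuclideanSpace ℝ (Fin n)) M]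
  [RiemannianBundle (fun x : M ↦ TangentSpace (𝓡 n) x)] {f h : M → ℝ} {U : Set M}

theorem inner_grad (f : M → ℝ) (x : M) (v : TangentSpace (𝓡 n) x) :
    inner ℝ (grad f x) v = mfderiv (𝓡 n) 𝓘(ℝ, ℝ) f x v :=
  haveI : FiniteDimensional ℝ (TangentSpace (𝓡 n) x) :=
    inferInstanceAs (FiniteDimensional ℝ (EuclideanSpace ℝ (Fin n)))
  haveI : CompleteSpace (TangentSpace (𝓡 n) x) := FiniteDimensional.complete ℝ _
  InnerProductSpace.toDual_symm_apply

theorem grad_eq_zero {x : M} (hf : ¬ MDifferentiableAt (𝓡 n) 𝓘(ℝ, ℝ) f x) :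
    grad (n := n) f x = 0 := by
  rw [grad, mfderiv_zero_of_not_mdifferentiableAt hf]
  exact map_zero _

theorem grad_eq_of_forall {x : M} {w : TangentSpace (𝓡 n) x}
    (hw : ∀ v, mfderiv (𝓡 n) 𝓘(ℝ, ℝ) f x v = inner ℝ w v) : grad (n := n) f x = w :=
  ext_inner_right ℝ fun v ↦ (inner_grad f x v).trans (hw v)

theorem grad_mul {x : M} (hf : MDifferentiableAt (𝓡 n) 𝓘(ℝ, ℝ) f x)
    (hh : MDifferentiableAt (𝓡 n) 𝓘(ℝ, ℝ) h x) :
    grad (n := n) (fun x ↦ f x * h x) x = f x • grad h x + h x • grad f x := by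
  refine grad_eq_of_forall fun v ↦ ?_
  have := (hf.hasMFDerivAt.mul hh.hasMFDerivAt).mfderiv
  rw [inner_add_left, inner_smul_left, inner_smul_left, inner_grad, inner_grad]
  exact congr($this v)

theorem grad_add {x : M} (hf : MDifferentiableAt (𝓡 n) 𝓘(ℝ, ℝ) f x)
    (hh : MDifferentiableAt (𝓡 n) 𝓘(ℝ, ℝ) h x) :
    grad (n := n) (fun x ↦ f x + h x) x = grad f x + grad h x := by
  refine grad_eq_of_forall fun v ↦ ?_
  have := (hf.hasMFDerivAt.add hh.hasMFDerivAt).mfderiv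
  rw [inner_add_left, inner_grad, inner_grad]
  exact congr($this v)

theorem grad_sum {ι : Type*} (s : Finset ι) {F : ι → M → ℝ} {x : M}
    (hF : ∀ i, MDifferentiableAt (𝓡 n) 𝓘(ℝ, ℝ) (F i) x) :
    MDifferentiableAt (𝓡 n) 𝓘(ℝ, ℝ) (fun x ↦ ∑ i ∈ s, F i x) x ∧
    grad (n := n) (fun x ↦ ∑ i ∈ s, F i x) x = ∑ i ∈ s, grad (F i) x := by
  classical
  induction s using Finset.induction_on with
  | empty =>
    simp only [Finset.sum_empty]
    refine ⟨mdifferentiableAt_const, grad_eq_of_forall fun v ↦ ?_⟩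
    rw [mfderiv_const, inner_zero_left]; rfl
  | insert i s hi ih =>
    simp only [Finset.sum_insert hi]
    exact ⟨(hF i).add ih.1, by rw [grad_add (hF i) ih.1, ih.2]⟩

theorem grad_comp {x : M} {F : ℝ → ℝ} {c : ℝ} (hf : MDifferentiableAt (𝓡 n) 𝓘(ℝ, ℝ) f x)
    (hF : HasDerivAt F c (f x)) : MDifferentiableAt (𝓡 n) 𝓘(ℝ, ℝ) (fun x ↦ F (f x)) x ∧
    grad (n := n) (fun x ↦ F (f x)) x = c • grad f x := by
  have h1 := hF.hasFDerivAt.hasMFDerivAt.comp x hf.hasMFDerivAt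
  refine ⟨h1.mdifferentiableAt, grad_eq_of_forall fun v ↦ ?_⟩
  have := h1.mfderiv
  rw [inner_smul_left, inner_grad]
  refine (congr($this v)).trans ?_
  exact mul_comm (show ℝ from mfderiv (𝓡 n) 𝓘(ℝ, ℝ) f x v) c

theorem grad_eq_zero_of_notMem_tsupport {x : M} (hx : x ∉ tsupport f) :
    grad (n := n) f x = 0 := by
  refine grad_eq_of_forall fun v ↦ ?_
  have h1 : f =ᶠ[𝓝 x] fun _ ↦ 0 := notMem_tsupport_iff_eventuallyEq.1 hx
  rw [h1.mfderiv_eq, mfderiv_const, inner_zero_left]; rfl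

variable [IsManifold (𝓡 n) ∞ M]

attribute [local instance] normedAddCommGroupTangentSpaceVectorSpace
attribute [local instance] normedSpaceTangentSpaceVectorSpace

/-- No differentiability is needed: where `f` is not differentiable, both sides take the default
value zero. Measurability of inner products of gradients therefore holds for arbitrary functions. -/
theorem fderiv_chart_coordVector {p : M} {y : EuclideanSpace ℝ (Fin n)}
    (hy : y ∈ (extChartAt (𝓡 n) p).target) (i : Fin n) (f : M → ℝ) :
    fderiv ℝ (f ∘ (extChartAt (𝓡 n) p).symm) y (EuclideanSpace.single i (1 : ℝ)) =
      inner ℝ (grad f ((extChartAt (𝓡 n) p).symm y)) (coordVector p y i) := by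
  by_cases hd : MDifferentiableAt (𝓡 n) 𝓘(ℝ, ℝ) f ((extChartAt (𝓡 n) p).symm y)
  · rw [inner_grad, (hasFDerivAt_comp_extChartAt_symm hy hd).2]; rfl
  · rw [grad_eq_zero hd, inner_zero_left, fderiv_zero_of_not_differentiableAt]
    · rfl
    · intro h
      refine hd (mdifferentiableAt_of_chart ((extChartAt (𝓡 n) p).map_target hy) ?_)
      rwa [(extChartAt (𝓡 n) p).right_inv hy]

/-- The inner product of two gradients in coordinates. -/
theorem inner_grad_grad_chart {p : M} {y : EuclideanSpace ℝ (Fin n)}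
    (hy : y ∈ (extChartAt (𝓡 n) p).target) (f h : M → ℝ) :
    inner ℝ (grad (n := n) f ((extChartAt (𝓡 n) p).symm y))
        (grad h ((extChartAt (𝓡 n) p).symm y)) =
      ((metricMatrix p y)⁻¹.mulVec fun i ↦
        fderiv ℝ (f ∘ (extChartAt (𝓡 n) p).symm) y (EuclideanSpace.single i (1 : ℝ))) ⬝ᵥ
      fun i ↦ fderiv ℝ (h ∘ (extChartAt (𝓡 n) p).symm) y (EuclideanSpace.single i (1 : ℝ)) := by
  simp only [fderiv_chart_coordVector hy]
  set x := (extChartAt (𝓡 n) p).symm y with hx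
  -- The coordinates `a` of `∇f` solve `G a = df`, so `⟨∇f, ∇h⟩ = a · dh` with `a = G⁻¹ df`.
  set a : EuclideanSpace ℝ (Fin n) :=
    mfderiv (𝓡 n) 𝓘(ℝ, EuclideanSpace ℝ (Fin n)) (extChartAt (𝓡 n) p) x (grad f x) with ha
  have hgf : grad f x = ∑ j, a j • coordVector p y j := by
    apply (mfderiv_extChartAt_bijective ((extChartAt (𝓡 n) p).map_target hy)).1
    rw [map_sum]
    have hsum : a = ∑ k, a k • EuclideanSpace.single k (1 : ℝ) := by
      simpa using ((EuclideanSpace.basisFun (Fin n) ℝ).sum_repr a).symm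
    refine hsum.trans (Finset.sum_congr rfl fun k _ ↦ ?_)
    rw [map_smul]
    congr 1
    exact (mfderiv_extChartAt_mfderiv_symm hy _).symm
  have hG : (fun i ↦ inner ℝ (grad f x) (coordVector p y i)) =
      (metricMatrix p y).mulVec a.ofLp := by
    ext i
    rw [hgf, sum_inner]
    simp only [inner_smul_left, conj_trivial, Matrix.mulVec, dotProduct, metricMatrix,
      Matrix.of_apply]
    refine Finset.sum_congr rfl fun j _ ↦ ?_
    rw [real_inner_comm, mul_comm]
  have hdet : IsUnit (metricMatrix p y).det := (metricMatrix_posDef hy).det_pos.ne'.isUnit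
  rw [hG, Matrix.mulVec_mulVec, Matrix.nonsing_inv_mul _ hdet, Matrix.one_mulVec, hgf, sum_inner]
  simp only [inner_smul_left, conj_trivial, dotProduct]
  refine Finset.sum_congr rfl fun j _ ↦ ?_
  rw [real_inner_comm]

variable [IsContMDiffRiemannianBundle (𝓡 n) ∞ (EuclideanSpace ℝ (Fin n))
      (fun x : M ↦ TangentSpace (𝓡 n) x)]

/-- Near each point, the gradient is controlled by the Lipschitz constant in the chart. -/
theorem exists_norm_grad_le (p : M) :
    ∃ B : ℝ, 0 < B ∧ ∀ᶠ x in 𝓝 p, x ∈ (extChartAt (𝓡 n) p).source ∧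
      ∀ (f : M → ℝ) (K : NNReal) (t : Set (EuclideanSpace ℝ (Fin n))),
        t ∈ 𝓝 (extChartAt (𝓡 n) p x) →
        LipschitzOnWith K (f ∘ (extChartAt (𝓡 n) p).symm) t → ‖grad (n := n) f x‖ ≤ K * B := by
  -- `B` bounds the differential of the chart near `p`. If `w` is the image of `∇f`, then `|∇f|² =
  -- d(f ∘ chart⁻¹)(w) ≤ K |w| ≤ K B |∇f|`, and one factor cancels.
  obtain ⟨B, hB, hBp⟩ := eventually_norm_mfderiv_extChartAt_lt (𝓡 n) p
  refine ⟨B, hB, ?_⟩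
  filter_upwards [hBp, extChartAt_source_mem_nhds (I := 𝓡 n) p] with x hx hxs
  refine ⟨hxs, fun f K t ht hK ↦ ?_⟩
  by_cases hd : MDifferentiableAt (𝓡 n) 𝓘(ℝ, ℝ) f x
  swap
  · rw [grad_eq_zero hd, norm_zero]; positivity
  have hy := (extChartAt (𝓡 n) p).map_source hxs
  set w : EuclideanSpace ℝ (Fin n) :=
    mfderiv (𝓡 n) 𝓘(ℝ, EuclideanSpace ℝ (Fin n)) (extChartAt (𝓡 n) p) x (grad f x) with hw
  have h1 : inner ℝ (grad (n := n) f x) (grad f x) =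
      fderiv ℝ (f ∘ (extChartAt (𝓡 n) p).symm) (extChartAt (𝓡 n) p x) w := by
    have hdq : MDifferentiableAt (𝓡 n) 𝓘(ℝ, EuclideanSpace ℝ (Fin n)) (extChartAt (𝓡 n) p) x :=
      mdifferentiableAt_extChartAt (by rwa [← extChartAt_source (I := 𝓡 n)])
    have hd' : MDifferentiableAt (𝓡 n) 𝓘(ℝ, ℝ) f
        ((extChartAt (𝓡 n) p).symm (extChartAt (𝓡 n) p x)) := by
      rwa [(extChartAt (𝓡 n) p).left_inv hxs]
    have h2 := (hasFDerivAt_comp_extChartAt_symm hy hd').1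
    have h3 := mfderiv_comp x h2.mdifferentiableAt hdq
    have h4 : (f ∘ (extChartAt (𝓡 n) p).symm) ∘ extChartAt (𝓡 n) p =ᶠ[𝓝 x] f := by
      filter_upwards [(isOpen_extChartAt_source (I := 𝓡 n) p).mem_nhds hxs] with z hz
      simp only [Function.comp_apply, (extChartAt (𝓡 n) p).left_inv hz]
    rw [h4.mfderiv_eq, mfderiv_eq_fderiv] at h3
    rw [inner_grad]
    exact congr($h3 (grad f x))
  have h2 : ‖w‖ ≤ B * ‖grad (n := n) f x‖ :=
    (ContinuousLinearMap.le_opNorm _ _).trans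
      (mul_le_mul_of_nonneg_right hx.le (norm_nonneg _))
  have h3 : ‖grad (n := n) f x‖ * ‖grad (n := n) f x‖ ≤ K * B * ‖grad (n := n) f x‖ := by
    rw [← real_inner_self_eq_norm_mul_norm, h1]
    calc _ ≤ ‖fderiv ℝ (f ∘ (extChartAt (𝓡 n) p).symm) (extChartAt (𝓡 n) p x) w‖ :=
          Real.le_norm_self _
      _ ≤ K * ‖w‖ := (ContinuousLinearMap.le_opNorm _ _).trans
          (mul_le_mul_of_nonneg_right (norm_fderiv_le_of_lipschitzOn ℝ ht hK) (norm_nonneg _))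
      _ ≤ K * (B * ‖grad (n := n) f x‖) := by gcongr
      _ = _ := by ring
  rcases (norm_nonneg (grad (n := n) f x)).eq_or_lt with h0 | h0
  · rw [← h0]; positivity
  · exact le_of_mul_le_mul_right h3 h0

variable [MeasurableSpace M] [BorelSpace M] [SecondCountableTopology M]

/-- In coordinates the inverse metric is continuous, and the Fréchet derivative of any function is
measurable. -/
theorem aestronglyMeasurable_inner_grad (p : M) (f h : M → ℝ) :
    AEStronglyMeasurable (fun x ↦ inner ℝ (grad (n := n) f x) (grad h x))
      ((riemannianVolume n M).restrict (extChartAt (𝓡 n) p).source) := by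
  refine aestronglyMeasurable_of_chart ?_ fun y hy ↦ inner_grad_grad_chart hy f h
  have hinv : ContinuousOn (fun y ↦ (metricMatrix p y)⁻¹) (extChartAt (𝓡 n) p).target := by
    have h1 : ContinuousOn (fun y ↦ (metricMatrix p y).det) (extChartAt (𝓡 n) p).target :=
      (Continuous.matrix_det continuous_id).comp_continuousOn (continuousOn_metricMatrix p)
    have h2 : ContinuousOn (fun y ↦ (metricMatrix p y).adjugate) (extChartAt (𝓡 n) p).target :=
      (Continuous.matrix_adjugate continuous_id).comp_continuousOn (continuousOn_metricMatrix p)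
    refine ((h1.inv₀ fun y hy ↦ (metricMatrix_posDef hy).det_pos.ne').smul h2).congr fun y _ ↦ ?_
    simp [Matrix.inv_def, Ring.inverse_eq_inv']
  have hij : ∀ i j, AEMeasurable (fun y ↦ (metricMatrix p y)⁻¹ i j)
      (volume.restrict (extChartAt (𝓡 n) p).target) := fun i j ↦
    (continuousOn_pi.1 (continuousOn_pi.1 hinv i) j).aemeasurable
      (isOpen_extChartAt_target p).measurableSet
  have hm : ∀ (f : M → ℝ) (i : Fin n), Measurable fun y ↦
      fderiv ℝ (f ∘ (extChartAt (𝓡 n) p).symm) y (EuclideanSpace.single i (1 : ℝ)) :=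
    fun f i ↦ measurable_fderiv_apply_const ℝ _ _
  simp only [dotProduct, Matrix.mulVec]
  exact Finset.aemeasurable_fun_sum _ fun i _ ↦ (Finset.aemeasurable_fun_sum _ fun j _ ↦
    (hij i j).mul (hm f j).aemeasurable).mul (hm h i).aemeasurable

/-- Both gradients are bounded near `p`, and the volume is locally finite. -/
theorem integrableAtFilter_inner_grad (hf : LocLipschitzOn n f U) (hh : LocLipschitzOn n h U)
    {p : M} (hp : p ∈ U) :
    IntegrableAtFilter (fun x ↦ inner ℝ (grad (n := n) f x) (grad h x)) (𝓝 p)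
      (riemannianVolume n M) := by
  obtain ⟨B, hB, hBp⟩ := exists_norm_grad_le (n := n) p
  obtain ⟨K, t, ht, hK⟩ := hf p hp
  obtain ⟨L, s, hs, hL⟩ := hh p hp
  obtain ⟨W, hW, hWf⟩ := (riemannianVolume n M).finiteAt_nhds p
  have ht' := (continuousAt_extChartAt (I := 𝓡 n) p).preimage_mem_nhds
    (eventually_mem_nhds_iff.2 ht)
  have hs' := (continuousAt_extChartAt (I := 𝓡 n) p).preimage_mem_nhds
    (eventually_mem_nhds_iff.2 hs)
  obtain ⟨N, hN, hNo, hpN⟩ := mem_nhds_iff.1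
    (inter_mem (inter_mem (inter_mem hBp ht') hs') hW)
  refine ⟨N, hNo.mem_nhds hpN, ?_⟩
  refine IntegrableOn.of_bound ((measure_mono fun x hx ↦ (hN hx).2).trans_lt hWf)
    ((aestronglyMeasurable_inner_grad p f h).mono_measure
      (Measure.restrict_mono (fun x hx ↦ (hN hx).1.1.1.1) le_rfl)) ((K * B) * (L * B)) ?_
  refine (ae_restrict_iff' hNo.measurableSet).2 (ae_of_all _ fun x hx ↦ ?_)
  refine (norm_inner_le_norm _ _).trans ?_
  have := (hN hx).1.1.1.2
  exact mul_le_mul (this f K t (hN hx).1.1.2 hK) (this h L s (hN hx).1.2 hL) (norm_nonneg _)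
    (by positivity)

omit [IsManifold (𝓡 n) ∞ M] [SecondCountableTopology M]
  [IsContMDiffRiemannianBundle (𝓡 n) ∞ (EuclideanSpace ℝ (Fin n))
    (fun x : M ↦ TangentSpace (𝓡 n) x)] in
/-- A locally integrable function times a continuous one is integrable if the product has its
support in a compact set. -/
theorem integrable_mul_of_support_subset [T2Space M] {G c : M → ℝ}
    (hG : ∀ p ∈ U, IntegrableAtFilter G (𝓝 p) (riemannianVolume n M)) (hc : ContinuousOn c U)
    {S : Set M} (hS : IsCompact S) (hSU : S ⊆ U) (hcS : ∀ x, x ∉ S → c x * G x = 0) :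
    Integrable (fun x ↦ c x * G x) (riemannianVolume n M) := by
  have := ChartedSpace.locallyCompactSpace (EuclideanSpace ℝ (Fin n)) M
  have h1 : LocallyIntegrableOn G S (riemannianVolume n M) := fun x hx ↦
    (hG x (hSU hx)).filter_mono nhdsWithin_le_nhds
  have h2 := (h1.integrableOn_isCompact hS).continuousOn_mul (hc.mono hSU) hS
  refine (integrableOn_iff_integrable_of_support_subset fun x hx ↦ ?_).1 h2
  by_contra h
  exact hx (hcS x h)

theorem integrable_of_continuousOn [T2Space M] {c : M → ℝ} (hc : ContinuousOn c U)
    {S : Set M} (hS : IsCompact S) (hSU : S ⊆ U) (hcS : ∀ x, x ∉ S → c x = 0) :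
    Integrable c (riemannianVolume n M) := by
  have := integrable_mul_of_support_subset (n := n) (G := fun _ ↦ 1) (fun p _ ↦ ?_) hc hS hSU
    fun x hx ↦ by rw [hcS x hx, zero_mul]
  · simpa using this
  · obtain ⟨W, hW, hWf⟩ := (riemannianVolume n M).finiteAt_nhds p
    exact ⟨W, hW, integrableOn_const hWf.ne⟩

end Gradient

/-! ### From smooth to Lipschitz test functions. -/

section WeakInequality

open Filter Topology

variable {n : ℕ} {M : Type*} [TopologicalSpace M] [T2Space M] [SecondCountableTopology M]
  [ChartedSpace (EuclideanSpace ℝ (Fin n)) M] [IsManifold (𝓡 n) ∞ M]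

omit [T2Space M] [SecondCountableTopology M] in
/-- The coordinate expression, extended by zero, of a locally Lipschitz function with compact
support in a chart domain. -/
theorem exists_lipschitz_coordinate_expression {p : M} {η : M → ℝ} {U W : Set M}
    (hη : LocLipschitzOn n η U) (hW : W ⊆ (extChartAt (𝓡 n) p).source) (hWU : W ⊆ U)
    (hc : HasCompactSupport η) (hηW : tsupport η ⊆ W) :
    ∃ (ζ : EuclideanSpace ℝ (Fin n) → ℝ) (K : NNReal), LipschitzWith K ζ ∧ HasCompactSupport ζ ∧
      tsupport ζ ⊆ extChartAt (𝓡 n) p '' W ∧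
      (∀ y ∈ (extChartAt (𝓡 n) p).target, ζ y = η ((extChartAt (𝓡 n) p).symm y)) ∧
      ∀ y, y ∉ (extChartAt (𝓡 n) p).target → ζ y = 0 := by
  classical
  set ζ : EuclideanSpace ℝ (Fin n) → ℝ := fun y ↦
    if y ∈ (extChartAt (𝓡 n) p).target then η ((extChartAt (𝓡 n) p).symm y) else 0 with hζ
  have hK : IsCompact (extChartAt (𝓡 n) p '' tsupport η) :=
    hc.isCompact.image_of_continuousOn ((continuousOn_extChartAt p).mono (hηW.trans hW))
  have h0 : ∀ y, y ∉ extChartAt (𝓡 n) p '' tsupport η → ζ y = 0 := by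
    intro y hy
    by_cases hyt : y ∈ (extChartAt (𝓡 n) p).target
    · simp only [hζ, hyt, if_true]
      refine image_eq_zero_of_notMem_tsupport fun h ↦ hy ⟨_, h, ?_⟩
      exact (extChartAt (𝓡 n) p).right_inv hyt
    · simp only [hζ, hyt, if_false]
  have hts : tsupport ζ ⊆ extChartAt (𝓡 n) p '' tsupport η := by
    refine closure_minimal (fun y hy ↦ ?_) hK.isClosed
    by_contra h
    exact hy (h0 y h)
  have hcζ : HasCompactSupport ζ := HasCompactSupport.intro hK h0
  -- Near the image of the support, `ζ` is a coordinate expression of `η`; the complement of this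
  -- compact image is open and `ζ` vanishes on it.
  have hloc : LocallyLipschitz ζ := by
    intro y
    by_cases hy : y ∈ extChartAt (𝓡 n) p '' tsupport η
    · obtain ⟨x, hx, rfl⟩ := hy
      have hxs := hW (hηW hx)
      obtain ⟨K, t, ht, hK⟩ := hη.exists_lipschitzOnWith_chart (hWU (hηW hx)) hxs
      refine ⟨K, t ∩ (extChartAt (𝓡 n) p).target, inter_mem ht
        ((isOpen_extChartAt_target p).mem_nhds ((extChartAt (𝓡 n) p).map_source hxs)), ?_⟩
      intro a ha b hb
      simp only [hζ, ha.2, hb.2, if_true]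
      exact hK ha.1 hb.1
    · refine ⟨0, _, hK.isClosed.isOpen_compl.mem_nhds hy, fun a ha b hb ↦ ?_⟩
      simp [h0 a ha, h0 b hb]
  obtain ⟨K, hK⟩ := exists_lipschitzWith_of_hasCompactSupport hloc hcζ
  refine ⟨ζ, K, hK, hcζ, hts.trans (image_mono hηW), fun y hy ↦ ?_, fun y hy ↦ ?_⟩
  · simp only [hζ, hy, if_true]
  · simp only [hζ, hy, if_false]

omit [SecondCountableTopology M] in
/-- A smooth function with compact support in the target of a chart defines a smooth function on
the manifold. -/
theorem exists_contMDiff_of_chart {p : M} {g : EuclideanSpace ℝ (Fin n) → ℝ}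
    (hg : ContDiff ℝ ∞ g) {S : Set (EuclideanSpace ℝ (Fin n))} (hS : IsCompact S)
    (hSt : S ⊆ (extChartAt (𝓡 n) p).target) (hgS : tsupport g ⊆ S) :
    ∃ η : M → ℝ, ContMDiff (𝓡 n) 𝓘(ℝ, ℝ) ∞ η ∧
      tsupport η ⊆ (extChartAt (𝓡 n) p).symm '' S ∧
      (∀ x ∈ (extChartAt (𝓡 n) p).source, η x = g (extChartAt (𝓡 n) p x)) ∧
      ∀ x, x ∉ (extChartAt (𝓡 n) p).source → η x = 0 := by
  classical
  set η : M → ℝ := fun x ↦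
    if x ∈ (extChartAt (𝓡 n) p).source then g (extChartAt (𝓡 n) p x) else 0 with hη
  have hS' : IsCompact ((extChartAt (𝓡 n) p).symm '' S) :=
    hS.image_of_continuousOn ((continuousOn_extChartAt_symm p).mono hSt)
  have hts : tsupport η ⊆ (extChartAt (𝓡 n) p).symm '' S := by
    refine closure_minimal (fun x hx ↦ ?_) hS'.isClosed
    by_cases hxs : x ∈ (extChartAt (𝓡 n) p).source
    · refine ⟨extChartAt (𝓡 n) p x, hgS (subset_tsupport _ ?_), (extChartAt (𝓡 n) p).left_inv hxs⟩
      simpa only [hη, Function.mem_support, hxs, if_true] using hx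
    · exact absurd (if_neg hxs) hx
  refine ⟨η, contMDiff_of_tsupport fun x hx ↦ ?_, hts, fun x hx ↦ ?_, fun x hx ↦ ?_⟩
  · obtain ⟨y, hy, rfl⟩ := hts hx
    have hxs := (extChartAt (𝓡 n) p).map_target (hSt hy)
    have h1 : ContMDiffAt (𝓡 n) 𝓘(ℝ, EuclideanSpace ℝ (Fin n)) ∞ (extChartAt (𝓡 n) p)
        ((extChartAt (𝓡 n) p).symm y) :=
      contMDiffAt_extChartAt' (by rwa [← extChartAt_source (I := 𝓡 n)])
    refine (hg.contMDiff.contMDiffAt.comp _ h1).congr_of_eventuallyEq ?_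
    filter_upwards [(isOpen_extChartAt_source (I := 𝓡 n) p).mem_nhds hxs] with z hz
    simp only [hη, hz, if_true, Function.comp_apply]
  · simp only [hη, hx, if_true]
  · simp only [hη, hx, if_false]

variable [MeasurableSpace M] [BorelSpace M] [RiemannianBundle (fun x : M ↦ TangentSpace (𝓡 n) x)]
  [IsContMDiffRiemannianBundle (𝓡 n) ∞ (EuclideanSpace ℝ (Fin n))
      (fun x : M ↦ TangentSpace (𝓡 n) x)]

/-- The weak form `η ↦ ∫ c ⟨∇η, ∇f⟩ + b η`. -/
noncomputable def weakForm (c b f : M → ℝ) (η : M → ℝ) : ℝ :=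
  ∫ x, (c x * inner ℝ (grad (n := n) η x) (grad f x) + b x * η x) ∂(riemannianVolume n M)

variable {U : Set M} {c b f : M → ℝ}

theorem integrable_mul_inner_grad (hc : ContinuousOn c U)
    (hf : LocLipschitzOn n f U) {η : M → ℝ} (hη : LocLipschitzOn n η U)
    (hηc : HasCompactSupport η) (hηU : tsupport η ⊆ U) :
    Integrable (fun x ↦ c x * inner ℝ (grad (n := n) η x) (grad f x)) (riemannianVolume n M) :=
  integrable_mul_of_support_subset (fun _ hp ↦ integrableAtFilter_inner_grad hη hf hp) hc
    hηc.isCompact hηU fun x hx ↦ by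
      rw [grad_eq_zero_of_notMem_tsupport hx, inner_zero_left, mul_zero]

theorem integrable_weakForm (hc : ContinuousOn c U) (hb : ContinuousOn b U)
    (hf : LocLipschitzOn n f U) {η : M → ℝ} (hη : LocLipschitzOn n η U)
    (hηc : HasCompactSupport η) (hηU : tsupport η ⊆ U) :
    Integrable (fun x ↦ c x * inner ℝ (grad (n := n) η x) (grad f x) + b x * η x)
      (riemannianVolume n M) :=
  (integrable_mul_inner_grad hc hf hη hηc hηU).add <|
    integrable_of_continuousOn (n := n) (hb.mul hη.continuousOn) hηc.isCompact hηU fun x hx ↦ by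
      simp [image_eq_zero_of_notMem_tsupport hx]

omit [T2Space M] [SecondCountableTopology M] [MeasurableSpace M] [BorelSpace M] in
/-- Each point has a neighbourhood in a chart on which gradients are uniformly controlled. -/
theorem exists_good_nhds (hU : IsOpen U) (hf : LocLipschitzOn n f U) {p : M} (hp : p ∈ U) :
    ∃ W : Set M, IsOpen W ∧ p ∈ W ∧ W ⊆ U ∧ W ⊆ (extChartAt (𝓡 n) p).source ∧
      (∃ B : ℝ, 0 < B ∧ ∀ x ∈ W, ∀ (h : M → ℝ) (K : NNReal)
        (t : Set (EuclideanSpace ℝ (Fin n))), t ∈ 𝓝 (extChartAt (𝓡 n) p x) →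
        LipschitzOnWith K (h ∘ (extChartAt (𝓡 n) p).symm) t → ‖grad (n := n) h x‖ ≤ K * B) ∧
      ∃ B : ℝ, ∀ x ∈ W, ‖grad (n := n) f x‖ ≤ B := by
  obtain ⟨B, hB, hBp⟩ := exists_norm_grad_le (n := n) p
  obtain ⟨K, t, ht, hK⟩ := hf p hp
  have ht' := (continuousAt_extChartAt (I := 𝓡 n) p).preimage_mem_nhds
    (eventually_mem_nhds_iff.2 ht)
  obtain ⟨N, hN, hNo, hpN⟩ := mem_nhds_iff.1 (inter_mem (inter_mem hBp ht') (hU.mem_nhds hp))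
  exact ⟨N, hNo, hpN, fun x hx ↦ (hN hx).2, fun x hx ↦ (hN hx).1.1.1,
    ⟨B, hB, fun x hx ↦ (hN hx).1.1.2⟩, K * B, fun x hx ↦ (hN hx).1.1.2 f K t (hN hx).1.2 hK⟩

/-- Local version of `weakForm_nonneg_of_locLipschitzOn`. -/
theorem weakForm_nonneg_of_tsupport_subset (hc : ContinuousOn c U)
    (hb : ContinuousOn b U) (hf : LocLipschitzOn n f U)
    (H : ∀ η, IsTestFunctionOn n U η → (∀ x, 0 ≤ η x) → 0 ≤ weakForm (n := n) c b f η)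
    {p : M} {W : Set M} (hWo : IsOpen W) (hWU : W ⊆ U) (hWs : W ⊆ (extChartAt (𝓡 n) p).source)
    {B : ℝ} (hB0 : 0 < B) (hB : ∀ x ∈ W, ∀ (h : M → ℝ) (K : NNReal)
        (t : Set (EuclideanSpace ℝ (Fin n))), t ∈ 𝓝 (extChartAt (𝓡 n) p x) →
        LipschitzOnWith K (h ∘ (extChartAt (𝓡 n) p).symm) t → ‖grad (n := n) h x‖ ≤ K * B)
    {B' : ℝ} (hB' : ∀ x ∈ W, ‖grad (n := n) f x‖ ≤ B')
    {η : M → ℝ} (hη : LocLipschitzOn n η U) (hηc : HasCompactSupport η)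
    (hηW : tsupport η ⊆ W) (hη0 : ∀ x, 0 ≤ η x) : 0 ≤ weakForm (n := n) c b f η := by
  obtain ⟨ζ, K, hζK, hζc, hζW, hζη, hζ0⟩ :=
    exists_lipschitz_coordinate_expression hη hWs hWU hηc hηW
  have hWO : IsOpen (extChartAt (𝓡 n) p '' W) := by
    rw [(extChartAt (𝓡 n) p).image_eq_target_inter_inv_preimage hWs]
    exact (continuousOn_extChartAt_symm p).isOpen_inter_preimage
      (isOpen_extChartAt_target p) hWo
  have hWt : extChartAt (𝓡 n) p '' W ⊆ (extChartAt (𝓡 n) p).target := by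
    rintro _ ⟨x, hx, rfl⟩
    exact (extChartAt (𝓡 n) p).map_source (hWs hx)
  have hζn : ∀ y, 0 ≤ ζ y := by
    intro y
    by_cases hy : y ∈ (extChartAt (𝓡 n) p).target
    · rw [hζη y hy]; exact hη0 _
    · rw [hζ0 y hy]
  obtain ⟨g, S, hS, hSW, hgs, hgK, hgS, hg0, hgB, hglim, hgder⟩ :=
    exists_smooth_approx (μ := volume) hζK hζc hζn hWO hζW
  obtain ⟨D, hD⟩ := hζc.exists_bound_of_continuous hζK.continuous
  have hgD : ∀ k y, g k y ≤ D := hgB D fun y ↦ (Real.le_norm_self _).trans (hD y)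
  choose e hes heS hex he0 using fun k ↦
    exists_contMDiff_of_chart (p := p) (hgs k) hS (hSW.trans hWt) (hgS k)
  set S' := (extChartAt (𝓡 n) p).symm '' S with hS'
  have hS'c : IsCompact S' :=
    hS.image_of_continuousOn ((continuousOn_extChartAt_symm p).mono (hSW.trans hWt))
  have hS'W : S' ⊆ W := by
    rintro _ ⟨y, hy, rfl⟩
    obtain ⟨x, hx, rfl⟩ := hSW hy
    rwa [(extChartAt (𝓡 n) p).left_inv (hWs hx)]
  have hec : ∀ k, HasCompactSupport (e k) := fun k ↦
    hS'c.of_isClosed_subset (isClosed_tsupport _) (heS k)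
  have hetest : ∀ k, IsTestFunctionOn n U (e k) := fun k ↦
    ⟨hes k, hec k, (heS k).trans (hS'W.trans hWU)⟩
  have hen : ∀ k x, 0 ≤ e k x := by
    intro k x
    by_cases hx : x ∈ (extChartAt (𝓡 n) p).source
    · rw [hex k x hx]; exact hg0 _ _
    · rw [he0 k x hx]
  have hesymm : ∀ k, ∀ y ∈ (extChartAt (𝓡 n) p).target,
      (e k ∘ (extChartAt (𝓡 n) p).symm) y = g k y := by
    intro k y hy
    rw [Function.comp_apply, hex k _ ((extChartAt (𝓡 n) p).map_target hy),
      (extChartAt (𝓡 n) p).right_inv hy]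
  have hegrad : ∀ k, ∀ x ∈ W, ‖grad (n := n) (e k) x‖ ≤ K * B := by
    intro k x hx
    refine hB x hx (e k) K _ ((isOpen_extChartAt_target p).mem_nhds
      ((extChartAt (𝓡 n) p).map_source (hWs hx))) ?_
    intro y hy z hz
    rw [hesymm k y hy, hesymm k z hz]
    exact hgK k y z
  obtain ⟨Cc, hCc⟩ := hS'c.exists_bound_of_continuousOn (hc.mono (hS'W.trans hWU))
  obtain ⟨Cb, hCb⟩ := hS'c.exists_bound_of_continuousOn (hb.mono (hS'W.trans hWU))
  have hlim : Tendsto (fun k ↦ weakForm (n := n) c b f (e k)) atTop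
      (𝓝 (weakForm (n := n) c b f η)) := by
    refine tendsto_integral_of_dominated_convergence
      -- All approximants live in the fixed compact set `S'`. There `Cc` and `Cb` bound the
      -- coefficients, `K * B` the gradients of the approximants, `B'` that of `f`, and `D` the
      -- approximants themselves.
      (S'.indicator fun _ ↦ Cc * (K * B * B') + Cb * D) (fun k ↦ ?_) ?_ (fun k ↦ ?_) ?_
    · exact (integrable_weakForm hc hb hf (locLipschitzOn_of_contMDiff (hes k) U) (hec k)
        (hetest k).tsupport_subset).aestronglyMeasurable
    · exact (integrable_indicator_iff hS'c.measurableSet).2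
        (integrableOn_const hS'c.measure_lt_top.ne)
    · refine ae_of_all _ fun x ↦ ?_
      by_cases hx : x ∈ S'
      · rw [indicator_of_mem hx]
        have hxW := hS'W hx
        have hxs := hWs hxW
        have hCc0 := (norm_nonneg _).trans (hCc x hx)
        have hCb0 := (norm_nonneg _).trans (hCb x hx)
        refine (norm_add_le _ _).trans (add_le_add ?_ ?_)
        · rw [norm_mul]
          refine mul_le_mul (hCc x hx) ((norm_inner_le_norm _ _).trans ?_) (norm_nonneg _) hCc0
          exact mul_le_mul (hegrad k x hxW) (hB' x hxW) (norm_nonneg _) (by positivity)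
        · rw [norm_mul]
          refine mul_le_mul (hCb x hx) ?_ (norm_nonneg _) hCb0
          rw [Real.norm_of_nonneg (hen k x), hex k x hxs]
          exact hgD k _
      · rw [indicator_of_notMem hx]
        have hx' : x ∉ tsupport (e k) := fun h ↦ hx (heS k h)
        rw [grad_eq_zero_of_notMem_tsupport hx', image_eq_zero_of_notMem_tsupport hx']
        simp
    -- By the coordinate formula the inner product is linear in the derivative of the test function
    -- with coefficients independent of `k`, so almost everywhere convergence of the derivatives
    -- suffices.
    · have h1 := ae_of_ae_chart (n := n) (p := p) (P := fun x ↦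
        Tendsto (fun k ↦ inner ℝ (grad (n := n) (e k) x) (grad f x)) atTop
          (𝓝 (inner ℝ (grad (n := n) η x) (grad f x)))) (by
        filter_upwards [hgder] with y hy hyt
        have hev : ∀ k, fderiv ℝ (e k ∘ (extChartAt (𝓡 n) p).symm) y = fderiv ℝ (g k) y := by
          intro k
          refine Filter.EventuallyEq.fderiv_eq ?_
          filter_upwards [(isOpen_extChartAt_target (I := 𝓡 n) p).mem_nhds hyt] with z hz
          exact hesymm k z hz
        have hev' : fderiv ℝ (η ∘ (extChartAt (𝓡 n) p).symm) y = fderiv ℝ ζ y := by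
          refine Filter.EventuallyEq.fderiv_eq ?_
          filter_upwards [(isOpen_extChartAt_target (I := 𝓡 n) p).mem_nhds hyt] with z hz
          exact (hζη z hz).symm
        simp only [inner_grad_grad_chart hyt, hev, hev', dotProduct, Matrix.mulVec]
        refine tendsto_finsetSum _ fun i _ ↦ Tendsto.mul_const _ ?_
        refine tendsto_finsetSum _ fun j _ ↦ Tendsto.const_mul _ ?_
        exact ((ContinuousLinearMap.apply ℝ ℝ (EuclideanSpace.single j (1 : ℝ))).continuous.tendsto
          _).comp hy)
      filter_upwards [h1] with x hx
      by_cases hxs : x ∈ (extChartAt (𝓡 n) p).source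
      · refine ((hx hxs).const_mul _).add (Tendsto.const_mul _ ?_)
        have h2 := hglim (extChartAt (𝓡 n) p x)
        rw [hζη _ ((extChartAt (𝓡 n) p).map_source hxs),
          (extChartAt (𝓡 n) p).left_inv hxs] at h2
        exact h2.congr fun k ↦ (hex k x hxs).symm
      · have hx1 : ∀ k, x ∉ tsupport (e k) := fun k h ↦ hxs (hWs (hS'W (heS k h)))
        have hx2 : x ∉ tsupport η := fun h ↦ hxs (hWs (hηW h))
        simp only [grad_eq_zero_of_notMem_tsupport hx2, grad_eq_zero_of_notMem_tsupport (hx1 _),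
          image_eq_zero_of_notMem_tsupport hx2, image_eq_zero_of_notMem_tsupport (hx1 _)]
        exact tendsto_const_nhds
  exact ge_of_tendsto' hlim fun k ↦ H (e k) (hetest k) (hen k)

/-- A weak inequality that holds for smooth test functions holds for Lipschitz ones. -/
theorem weakForm_nonneg_of_locLipschitzOn (hU : IsOpen U) (hc : ContinuousOn c U)
    (hb : ContinuousOn b U) (hf : LocLipschitzOn n f U)
    (H : ∀ η, IsTestFunctionOn n U η → (∀ x, 0 ≤ η x) → 0 ≤ weakForm (n := n) c b f η)
    {η : M → ℝ} (hη : LocLipschitzOn n η U) (hηc : HasCompactSupport η)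
    (hηU : tsupport η ⊆ U) (hη0 : ∀ x, 0 ≤ η x) : 0 ≤ weakForm (n := n) c b f η := by
  have := ChartedSpace.locallyCompactSpace (EuclideanSpace ℝ (Fin n)) M
  choose W hWo hpW hWU hWs hWB hWB' using fun p : U ↦ exists_good_nhds hU hf p.2
  obtain ⟨T, hT⟩ := hηc.isCompact.elim_finite_subcover W hWo
    fun x hx ↦ mem_iUnion.2 ⟨⟨x, hηU hx⟩, hpW _⟩
  -- The partition sums to one on the support of `η`, so it splits `η` into nonnegative Lipschitz
  -- pieces, each supported in one good neighbourhood.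
  obtain ⟨χ, hχ⟩ := SmoothPartitionOfUnity.exists_isSubordinate (𝓡 n) (ι := T)
    (isClosed_tsupport η) (fun i ↦ W i) (fun i ↦ hWo i) (by
      intro x hx
      obtain ⟨i, hi, hxi⟩ := mem_iUnion₂.1 (hT hx)
      exact mem_iUnion.2 ⟨⟨i, hi⟩, hxi⟩)
  have hsub : ∀ i : T, tsupport (fun x ↦ χ i x * η x) ⊆ W i := fun i ↦
    (tsupport_mul_subset_left).trans (hχ i)
  have hsub' : ∀ i : T, tsupport (fun x ↦ χ i x * η x) ⊆ tsupport η := fun i ↦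
    tsupport_mul_subset_right
  have hχl : ∀ i : T, LocLipschitzOn n (fun x ↦ χ i x * η x) U := fun i ↦
    (locLipschitzOn_of_contMDiff (χ i).contMDiff U).mul hη
  have hχc : ∀ i : T, HasCompactSupport (fun x ↦ χ i x * η x) := fun i ↦
    hηc.of_isClosed_subset (isClosed_tsupport _) (hsub' i)
  have hpos : ∀ i : T, 0 ≤ weakForm (n := n) c b f (fun x ↦ χ i x * η x) := by
    intro i
    obtain ⟨B, hB0, hB⟩ := hWB i
    obtain ⟨B', hB'⟩ := hWB' i
    exact weakForm_nonneg_of_tsupport_subset hc hb hf H (hWo i) (hWU i) (hWs i) hB0 hB hB'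
      (hχl i) (hχc i) (hsub i) fun x ↦ mul_nonneg (χ.nonneg i x) (hη0 x)
  have hηsum : η = fun x ↦ ∑ i : T, χ i x * η x := by
    ext x
    rw [← Finset.sum_mul]
    by_cases hx : x ∈ tsupport η
    · rw [← finsum_eq_sum_of_fintype, χ.sum_eq_one hx, one_mul]
    · rw [image_eq_zero_of_notMem_tsupport hx, mul_zero]
  have hsum : weakForm (n := n) c b f η =
      ∑ i : T, weakForm (n := n) c b f (fun x ↦ χ i x * η x) := by
    simp only [weakForm]
    rw [← integral_finsetSum _ fun i _ ↦ integrable_weakForm hc hb hf (hχl i) (hχc i)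
      ((hsub i).trans (hWU i))]
    refine integral_congr_ae ?_
    -- The gradient of the sum splits only where the pieces are differentiable, hence the passage to
    -- almost every point.
    filter_upwards [hη.ae_mdifferentiableAt] with x hx
    by_cases hxη : x ∈ tsupport η
    swap
    · have hxi : ∀ i : T, x ∉ tsupport (fun x ↦ χ i x * η x) := fun i h ↦ hxη (hsub' i h)
      simp only [grad_eq_zero_of_notMem_tsupport hxη, grad_eq_zero_of_notMem_tsupport (hxi _),
        image_eq_zero_of_notMem_tsupport hxη]
      simp
    have hd : ∀ i : T, MDifferentiableAt (𝓡 n) 𝓘(ℝ, ℝ) (fun x ↦ χ i x * η x) x := fun i ↦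
      ((χ i).contMDiff.mdifferentiableAt (by simp)).mul (hx (hηU hxη))
    conv_lhs => rw [hηsum]
    rw [(grad_sum _ hd).2, sum_inner, Finset.mul_sum, Finset.mul_sum,
      Finset.sum_add_distrib]
  rw [hsum]
  exact Finset.sum_nonneg fun i _ ↦ hpos i

end WeakInequality

/-! ### The pointwise identity and its integration. -/

section Hardy

open Filter Topology

/-- The pointwise inequality behind the Hardy inequality: the left-hand side is the square of
`∇φ - φ ∇h / h`, where `h = ρ ^ (-β) δ ^ (1 / 2)`. -/
theorem hardy_pointwise {H : Type*} [NormedAddCommGroup H] [InnerProductSpace ℝ H]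
    (gφ gρ ga gδ : H) {a ρ δ φ P Q q k m α C β : ℝ} (ha : 0 ≤ a) (hρ : 0 < ρ) (hδ : 0 < δ)
    (hP : 0 ≤ P) (hq : 0 ≤ q) (hk : 0 < k) (hQ : Q = P * inner ℝ gρ gρ)
    (hkm : m * k = q * ρ ^ 2) (hβ : β = (C + α - 1) / 2) :
    0 ≤ a * (q * ρ ^ 2) * P * inner ℝ gφ gφ - β ^ 2 * (a * q * φ ^ 2 * Q)
      - β * (q * ρ * φ ^ 2 * P * inner ℝ ga gρ)
      - 1 / 4 * (a * (q * ρ ^ 2) * φ ^ 2 / δ ^ 2 * P * inner ℝ gδ gδ)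
      - β * (-P * inner ℝ (a • ((q * ρ) • (φ • gφ + φ • gφ) + (φ * φ) • (((α - 1) * q) • gρ))
          + (q * ρ * (φ * φ)) • ga) gρ - C / ρ * Q * (a * (q * ρ * (φ * φ))))
      - 1 / 2 * (a * k * P * inner ℝ ((m * δ⁻¹) • (φ • gφ + φ • gφ) + (φ * φ) •
          (m • (-(δ ^ 2)⁻¹ • gδ) + δ⁻¹ • ((2 * β * (m / ρ)) • gρ))) gδ) := by
  -- The letters stand for `q = ρ^(α-2)`, `k = ρ^(1-C)` and `m = ρ^(C+α-1)`. The single relation `m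
  -- k = q ρ²` replaces real exponents and leaves a rational identity.
  have hm : m = q * ρ ^ 2 / k := by rw [← hkm]; field_simp
  have hα : α = 2 * β + 1 - C := by rw [hβ]; ring
  have key := mul_nonneg (mul_nonneg (mul_nonneg ha (mul_nonneg hq (sq_nonneg ρ))) hP)
    (real_inner_self_nonneg (x := gφ + (φ * β / ρ) • gρ - (φ / (2 * δ)) • gδ))
  refine key.trans_eq ?_
  subst hm hQ hα
  simp only [inner_add_left, inner_sub_left, inner_add_right, inner_sub_right, inner_smul_left,
    inner_smul_right, conj_trivial, real_inner_comm gφ gρ, real_inner_comm gδ gρ,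
    real_inner_comm gφ gδ]
  field_simp
  ring

/-- Integration of the pointwise inequality. -/
theorem hardy_integral {X : Type*} [MeasurableSpace X] {ν : Measure X} {A R S T w₁ w₂ : X → ℝ}
    {β : ℝ} (hβ : 0 ≤ β) (hA : Integrable A ν) (hR : Integrable R ν) (hS : Integrable S ν)
    (hT : Integrable T ν) (hi₁ : Integrable w₁ ν) (hi₂ : Integrable w₂ ν)
    (hw₁ : 0 ≤ ∫ x, w₁ x ∂ν) (hw₂ : 0 ≤ ∫ x, w₂ x ∂ν)
    (h : ∀ᵐ x ∂ν, 0 ≤ A x - β ^ 2 * R x - β * S x - 1 / 4 * T x - β * w₁ x - 1 / 2 * w₂ x) :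
    β ^ 2 * ∫ x, R x ∂ν + β * ∫ x, S x ∂ν + 1 / 4 * ∫ x, T x ∂ν ≤ ∫ x, A x ∂ν := by
  have j₁ : Integrable (fun x ↦ β ^ 2 * R x + β * S x) ν :=
    (hR.const_mul (β ^ 2)).add (hS.const_mul β)
  have j₂ : Integrable (fun x ↦ β ^ 2 * R x + β * S x + 1 / 4 * T x) ν :=
    j₁.add (hT.const_mul (1 / 4))
  have j₃ : Integrable (fun x ↦ β ^ 2 * R x + β * S x + 1 / 4 * T x + β * w₁ x) ν :=
    j₂.add (hi₁.const_mul β)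
  have j₄ : Integrable
      (fun x ↦ β ^ 2 * R x + β * S x + 1 / 4 * T x + β * w₁ x + 1 / 2 * w₂ x) ν :=
    j₃.add (hi₂.const_mul (1 / 2))
  have hle := integral_mono_ae j₄ hA (by filter_upwards [h] with x hx; linarith)
  rw [integral_add j₃ (hi₂.const_mul (1 / 2)), integral_add j₂ (hi₁.const_mul β),
    integral_add j₁ (hT.const_mul (1 / 4)),
    integral_add (hR.const_mul (β ^ 2)) (hS.const_mul β)] at hle
  simp only [integral_const_mul] at hle
  have := mul_nonneg hβ hw₁
  linarith

end Hardy

/-! ### Translation of the affine hypotheses into weak Riemannian inequalities. -/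

section AffineDivergence

open Filter Topology

variable {n : ℕ} {M : Type*} [TopologicalSpace M] [ChartedSpace (EuclideanSpace ℝ (Fin n)) M]
  [RiemannianBundle (fun x : M ↦ TangentSpace (𝓡 n) x)]

/-- Two rank-one operators contribute `λ du(Y)` and `μ du(Y)`; the multiple of the identity
contributes `n λ du(Y)`. -/
theorem trace_connectionDifference (lam mu : ℝ) (u : M → ℝ) (x : M) (Y : TangentSpace (𝓡 n) x) :
    LinearMap.trace ℝ (TangentSpace (𝓡 n) x) (connectionDifference lam mu u x Y) =
      ((n + 1) * lam + mu) * inner ℝ (grad u x) Y := by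
  have h : connectionDifference lam mu u x Y =
      (lam • (innerₛₗ ℝ (grad (n := n) u x))).smulRight Y +
        (lam * inner ℝ (grad u x) Y) • LinearMap.id +
        (mu • (innerₛₗ ℝ Y)).smulRight (grad u x) := by
    ext X
    simp [connectionDifference, real_inner_comm Y X]
  have : Module.Free ℝ (TangentSpace (𝓡 n) x) :=
    inferInstanceAs (Module.Free ℝ (EuclideanSpace ℝ (Fin n)))
  have : Module.Finite ℝ (TangentSpace (𝓡 n) x) :=
    inferInstanceAs (Module.Finite ℝ (EuclideanSpace ℝ (Fin n)))
  have hn : Module.finrank ℝ (TangentSpace (𝓡 n) x) = n :=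
    (finrank_euclideanSpace_fin (𝕜 := ℝ) (n := n))
  rw [h, map_add, map_add, map_smul, LinearMap.trace_smulRight, LinearMap.trace_smulRight,
    LinearMap.trace_id, hn]
  simp only [LinearMap.smul_apply, innerₛₗ_apply_apply, smul_eq_mul, real_inner_comm Y]
  rw [real_inner_comm]
  ring

omit [RiemannianBundle (fun x : M ↦ TangentSpace (𝓡 n) x)] in
theorem contMDiff_exp_rpow {u : M → ℝ} (hu : ContMDiff (𝓡 n) 𝓘(ℝ, ℝ) ∞ u) (s : ℝ) :
    ContMDiff (𝓡 n) 𝓘(ℝ, ℝ) ∞ fun x ↦ Real.exp (u x) ^ s := by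
  simp only [← Real.exp_mul]
  have : ContDiff ℝ ∞ fun t : ℝ ↦ Real.exp (t * s) := by fun_prop
  exact this.contMDiff.comp hu

theorem grad_exp_rpow {u : M → ℝ} (hu : ContMDiff (𝓡 n) 𝓘(ℝ, ℝ) ∞ u) (s : ℝ) (x : M) :
    grad (n := n) (fun x ↦ Real.exp (u x) ^ s) x = (s * Real.exp (u x) ^ s) • grad u x := by
  simp only [← Real.exp_mul]
  have h1 := ((hasDerivAt_id (u x)).mul_const s).exp
  have h2 := (grad_comp (hu.mdifferentiableAt (by simp)) h1).2
  simp only [id] at h2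
  rw [h2]
  congr 1
  ring

theorem IsTestFunctionOn.exp_rpow_mul {u ψ : M → ℝ} {U : Set M}
    (hu : ContMDiff (𝓡 n) 𝓘(ℝ, ℝ) ∞ u) (hψ : IsTestFunctionOn n U ψ) (s : ℝ) :
    IsTestFunctionOn n U fun x ↦ Real.exp (u x) ^ s * ψ x where
  contMDiff := (contMDiff_exp_rpow hu s).mul hψ.contMDiff
  hasCompactSupport := hψ.hasCompactSupport.mul_left
  tsupport_subset := tsupport_mul_subset_right.trans hψ.tsupport_subset

/-- `div^D W = V ^ (-τ) div (V ^ τ W)` in the sense of distributions. -/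
theorem affineDiv_exp_rpow_mul [MeasurableSpace M] {u ψ : M → ℝ}
    (hu : ContMDiff (𝓡 n) 𝓘(ℝ, ℝ) ∞ u) (hψ : ContMDiff (𝓡 n) 𝓘(ℝ, ℝ) ∞ ψ) {lam mu τ : ℝ}
    (hτ : τ = (n + 1) * lam + mu) (W : (x : M) → TangentSpace (𝓡 n) x) :
    affineDiv lam mu u W (fun x ↦ Real.exp (u x) ^ τ * ψ x) =
      ∫ x, -(Real.exp (u x) ^ τ * inner ℝ (grad ψ x) (W x)) ∂(riemannianVolume n M) := by
  refine integral_congr_ae (ae_of_all _ fun x ↦ ?_)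
  simp only
  -- The part `τ V^τ ψ ∇u` of the gradient of `V^τ ψ` cancels the trace term.
  rw [trace_connectionDifference, ← hτ,
    grad_mul ((contMDiff_exp_rpow hu τ).mdifferentiableAt (by simp))
      (hψ.mdifferentiableAt (by simp)), grad_exp_rpow hu]
  simp only [inner_add_left, inner_smul_left, conj_trivial]
  ring

variable [T2Space M] [SecondCountableTopology M] [IsManifold (𝓡 n) ∞ M] [MeasurableSpace M]
  [BorelSpace M] [IsContMDiffRiemannianBundle (𝓡 n) ∞ (EuclideanSpace ℝ (Fin n))
    (fun x : M ↦ TangentSpace (𝓡 n) x)]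

/-- Testing with `V^τ ψ`, which is again a nonnegative test function, gives `div(P∇ρ) ≥ (C/ρ) Q`
weakly. -/
theorem weakForm_nonneg_of_affineLaplacian {u ρ : M → ℝ} (hu : ContMDiff (𝓡 n) 𝓘(ℝ, ℝ) ∞ u)
    {lam mu τ C : ℝ} (hτ : τ = (n + 1) * lam + mu) (hρc : Continuous ρ)
    (hρ : LocLipschitzOn n ρ {x | ρ x ≠ 0})
    (h : DistribGE n {x | ρ x ≠ 0} (affineLaplacian n lam mu u ρ)
      (fun x ↦ C / ρ x * Real.exp (u x) ^ (lam - mu)))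
    {ψ : M → ℝ} (hψ : IsTestFunctionOn n {x | ρ x ≠ 0} ψ) (hψ0 : ∀ x, 0 ≤ ψ x) :
    0 ≤ weakForm (n := n) (fun x ↦ -Real.exp (u x) ^ (τ + mu - lam))
      (fun x ↦ -(C / ρ x * Real.exp (u x) ^ (τ + lam - mu))) ρ ψ := by
  have h1 := h _ (hψ.exp_rpow_mul hu τ) fun x ↦ mul_nonneg (by positivity) (hψ0 x)
  beta_reduce at h1
  rw [affineLaplacian, affineDiv_exp_rpow_mul hu hψ.contMDiff hτ] at h1
  have hexp : ∀ s : ℝ, Continuous fun x ↦ Real.exp (u x) ^ s := fun s ↦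
    (contMDiff_exp_rpow hu s).continuous
  have hψl := locLipschitzOn_of_contMDiff hψ.contMDiff {x | ρ x ≠ 0}
  have hc : ContinuousOn (fun x ↦ -Real.exp (u x) ^ (τ + mu - lam)) {x | ρ x ≠ 0} :=
    (hexp _).neg.continuousOn
  have hb : ContinuousOn (fun x ↦ -(C / ρ x * Real.exp (u x) ^ (τ + lam - mu)))
      {x | ρ x ≠ 0} :=
    ((continuousOn_const.div hρc.continuousOn fun x hx ↦ hx).mul (hexp _).continuousOn).neg
  have hbψ : Integrable (fun x ↦ -(C / ρ x * Real.exp (u x) ^ (τ + lam - mu)) * ψ x)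
      (riemannianVolume n M) := integrable_of_continuousOn (n := n) (hb.mul hψl.continuousOn)
    hψ.hasCompactSupport.isCompact hψ.tsupport_subset fun x hx ↦ by
      simp [image_eq_zero_of_notMem_tsupport hx]
  rw [weakForm, integral_add (integrable_mul_inner_grad hc hρ hψl hψ.hasCompactSupport
    hψ.tsupport_subset) hbψ]
  have e1 : ∫ x, C / ρ x * Real.exp (u x) ^ (lam - mu) * (Real.exp (u x) ^ τ * ψ x)
      ∂(riemannianVolume n M) = -∫ x, -(C / ρ x * Real.exp (u x) ^ (τ + lam - mu)) * ψ x
      ∂(riemannianVolume n M) := by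
    rw [← integral_neg]
    refine integral_congr_ae (ae_of_all _ fun x ↦ ?_)
    simp only
    rw [add_sub_assoc, Real.rpow_add (Real.exp_pos _)]
    ring
  have e2 : ∫ x, -(Real.exp (u x) ^ τ * inner ℝ (grad (n := n) ψ x) (affineGrad lam mu u ρ x))
      ∂(riemannianVolume n M) = ∫ x, -Real.exp (u x) ^ (τ + mu - lam) *
        inner ℝ (grad (n := n) ψ x) (grad ρ x) ∂(riemannianVolume n M) := by
    refine integral_congr_ae (ae_of_all _ fun x ↦ ?_)
    simp only [affineGrad, inner_smul_right]
    rw [add_sub_assoc, Real.rpow_add (Real.exp_pos _)]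
    ring
  rw [e1, e2] at h1
  linarith

-- Here the factor `V^τ` is part of the hypothesis, so `ψ` is inserted directly.
omit [T2Space M] [SecondCountableTopology M] [IsManifold (𝓡 n) ∞ M] [BorelSpace M]
  [IsContMDiffRiemannianBundle (𝓡 n) ∞ (EuclideanSpace ℝ (Fin n))
    (fun x : M ↦ TangentSpace (𝓡 n) x)] in
theorem weakForm_nonneg_of_affineDiv {u δ c : M → ℝ} {U : Set M}
    (hu : ContMDiff (𝓡 n) 𝓘(ℝ, ℝ) ∞ u) {lam mu τ : ℝ} (hτ : τ = (n + 1) * lam + mu)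
    (h : DistribGE n U (fun η ↦ - affineDiv (n := n) lam mu u
        (fun x ↦ c x • affineGrad (n := n) lam mu u δ x)
        (fun x ↦ Real.exp (u x) ^ τ * η x)) (fun _ ↦ 0))
    {ψ : M → ℝ} (hψ : IsTestFunctionOn n U ψ) (hψ0 : ∀ x, 0 ≤ ψ x) :
    0 ≤ weakForm (n := n) (fun x ↦ c x * Real.exp (u x) ^ (τ + mu - lam)) (fun _ ↦ 0) δ ψ := by
  have h1 := h ψ hψ hψ0
  simp only [zero_mul, integral_zero] at h1
  rw [affineDiv_exp_rpow_mul hu hψ.contMDiff hτ, ← integral_neg] at h1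
  refine h1.trans_eq (integral_congr_ae (ae_of_all _ fun x ↦ ?_))
  simp only [affineGrad, inner_smul_right]
  rw [add_sub_assoc, Real.rpow_add (Real.exp_pos _)]
  ring

end AffineDivergence

end AffineHardy

/-! ### The Hardy inequality. -/

/-- Improved weighted Hardy inequality for the affine connection `D = D^{λ,μ}`. -/
theorem mainTheorem8 (n : ℕ) (M : Type*) [TopologicalSpace M] [T2Space M]
    [SecondCountableTopology M] [MeasurableSpace M] [BorelSpace M]
    [ChartedSpace (EuclideanSpace ℝ (Fin n)) M] [IsManifold (𝓡 n) ∞ M]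
    [RiemannianBundle (fun x : M ↦ TangentSpace (𝓡 n) x)]
    [IsContMDiffRiemannianBundle (𝓡 n) ∞ (EuclideanSpace ℝ (Fin n))
      (fun x : M ↦ TangentSpace (𝓡 n) x)]
    (u : M → ℝ) (hu : ContMDiff (𝓡 n) 𝓘(ℝ, ℝ) ∞ u)
    (V : M → ℝ) (hV : ∀ x, V x = Real.exp (u x))
    (lam mu τ : ℝ) (hτ : τ = (n + 1) * lam + mu)
    (ρ a δ : M → ℝ) (α C : ℝ) (hC : 1 < C) (hCα : 0 < C + α - 1)
    (hρ_cont : Continuous ρ) (hρ_nonneg : ∀ x, 0 ≤ ρ x)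
    (hρ_lip : AffineHardy.LocLipschitzOn n ρ {x | ρ x ≠ 0})
    (ha_nonneg : ∀ x, ρ x ≠ 0 → 0 ≤ a x)
    (ha_lip : AffineHardy.LocLipschitzOn n a {x | ρ x ≠ 0})
    (hδ_pos : ∀ x, ρ x ≠ 0 → 0 < δ x)
    (hδ_lip : AffineHardy.LocLipschitzOn n δ {x | ρ x ≠ 0})
    (hρ_grad : ∀ᵐ x ∂(AffineHardy.riemannianVolume n M), ρ x ≠ 0 →
      ‖AffineHardy.affineGrad (n := n) lam mu u ρ x‖ = 1)
    (hρ_lap : AffineHardy.DistribGE n {x | ρ x ≠ 0}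
      (AffineHardy.affineLaplacian n lam mu u ρ) (fun x ↦ C / ρ x * V x ^ (lam - mu)))
    (haρ : ∀ᵐ x ∂(AffineHardy.riemannianVolume n M), ρ x ≠ 0 →
      0 ≤ inner ℝ (AffineHardy.affineGrad (n := n) lam mu u a x)
        (AffineHardy.affineGrad (n := n) lam mu u ρ x))
    (hδ_div : AffineHardy.DistribGE n {x | ρ x ≠ 0}
      (fun η ↦ - AffineHardy.affineDiv (n := n) lam mu u
        (fun x ↦ (a x * ρ x ^ (1 - C)) • AffineHardy.affineGrad (n := n) lam mu u δ x)
        (fun x ↦ V x ^ τ * η x))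
      (fun _ ↦ 0))
    (φ : M → ℝ) (hφ : AffineHardy.IsTestFunctionOn n {x | ρ x ≠ 0} φ) :
    (Integrable (fun x ↦ a x * ρ x ^ α * ‖AffineHardy.affineGrad (n := n) lam mu u φ x‖ ^ 2
        * V x ^ (τ + lam - mu)) (AffineHardy.riemannianVolume n M) ∧
      Integrable (fun x ↦ a x * ρ x ^ (α - 2) * φ x ^ 2 * V x ^ (τ + lam - mu))
        (AffineHardy.riemannianVolume n M) ∧
      Integrable (fun x ↦ ρ x ^ (α - 1) * φ x ^ 2
        * inner ℝ (AffineHardy.affineGrad (n := n) lam mu u a x)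
            (AffineHardy.affineGrad (n := n) lam mu u ρ x)
        * V x ^ (τ + lam - mu)) (AffineHardy.riemannianVolume n M) ∧
      Integrable (fun x ↦ a x * ρ x ^ α
        * (‖AffineHardy.affineGrad (n := n) lam mu u δ x‖ ^ 2 / δ x ^ 2) * φ x ^ 2
        * V x ^ (τ + lam - mu)) (AffineHardy.riemannianVolume n M)) ∧
    ((C + α - 1) / 2) ^ 2 *
        ∫ x, a x * ρ x ^ (α - 2) * φ x ^ 2 * V x ^ (τ + lam - mu)
          ∂(AffineHardy.riemannianVolume n M)
      + (C + α - 1) / 2 *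
        ∫ x, ρ x ^ (α - 1) * φ x ^ 2
          * inner ℝ (AffineHardy.affineGrad (n := n) lam mu u a x)
              (AffineHardy.affineGrad (n := n) lam mu u ρ x)
          * V x ^ (τ + lam - mu) ∂(AffineHardy.riemannianVolume n M)
      + 1 / 4 *
        ∫ x, a x * ρ x ^ α
          * (‖AffineHardy.affineGrad (n := n) lam mu u δ x‖ ^ 2 / δ x ^ 2) * φ x ^ 2
          * V x ^ (τ + lam - mu) ∂(AffineHardy.riemannianVolume n M)
    ≤ ∫ x, a x * ρ x ^ α * ‖AffineHardy.affineGrad (n := n) lam mu u φ x‖ ^ 2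
        * V x ^ (τ + lam - mu) ∂(AffineHardy.riemannianVolume n M) := by
  simp only [hV] at hρ_lap hδ_div ⊢
  set Ω : Set M := {x | ρ x ≠ 0} with hΩ
  set P : M → ℝ := fun x ↦ Real.exp (u x) ^ (τ + mu - lam) with hP
  set Q : M → ℝ := fun x ↦ Real.exp (u x) ^ (τ + lam - mu) with hQ
  set β : ℝ := (C + α - 1) / 2 with hβ
  have hφl := AffineHardy.locLipschitzOn_of_contMDiff hφ.contMDiff Ω
  have hφK := hφ.hasCompactSupport.isCompact
  have hφΩ : tsupport φ ⊆ Ω := hφ.tsupport_subset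
  have hexp : ∀ s : ℝ, ContinuousOn (fun x ↦ Real.exp (u x) ^ s) Ω := fun s ↦
    (AffineHardy.contMDiff_exp_rpow hu s).continuous.continuousOn
  have hΩo : IsOpen Ω := isOpen_ne_fun hρ_cont continuous_const
  have hρpos : ∀ x ∈ Ω, 0 < ρ x := fun x hx ↦ (hρ_nonneg x).lt_of_ne' hx
  have hρpow : ∀ s : ℝ, AffineHardy.LocLipschitzOn n (fun x ↦ ρ x ^ s) Ω := fun s ↦
    hρ_lip.comp (F := fun t ↦ t ^ s) fun x hx ↦ Real.contDiffAt_rpow_const_of_ne hx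
  have hδinv : AffineHardy.LocLipschitzOn n (fun x ↦ (δ x)⁻¹) Ω :=
    hδ_lip.comp (F := fun t ↦ t⁻¹) fun x hx ↦ contDiffAt_inv ℝ (hδ_pos x hx).ne'
  have hφφ := hφl.mul hφl
  -- The two test functions `a ρ^(α-1) φ²` and `ρ^(C+α-1) δ⁻¹ φ²`. The exponent in the second makes
  -- its product with the weight `a ρ^(1-C)` equal to `a ρ^α φ²/δ`, which produces the cross terms
  -- with `∇δ` in the square.
  have hη₁ := ha_lip.mul ((hρpow (α - 1)).mul hφφ)
  have hη₂ := ((hρpow (C + α - 1)).mul hδinv).mul hφφ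
  have hs₁ : tsupport (fun x ↦ a x * (ρ x ^ (α - 1) * (φ x * φ x))) ⊆ tsupport φ :=
    tsupport_mul_subset_right.trans (tsupport_mul_subset_right.trans tsupport_mul_subset_right)
  have hs₂ : tsupport (fun x ↦ ρ x ^ (C + α - 1) * (δ x)⁻¹ * (φ x * φ x)) ⊆ tsupport φ :=
    tsupport_mul_subset_right.trans tsupport_mul_subset_right
  have hc₁ := hφ.hasCompactSupport.of_isClosed_subset (isClosed_tsupport _) hs₁
  have hc₂ := hφ.hasCompactSupport.of_isClosed_subset (isClosed_tsupport _) hs₂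
  -- the two hypotheses, tested with Lipschitz functions
  have hcw₁ : ContinuousOn (fun x ↦ -P x) Ω := (hexp _).neg
  have hbw₁ : ContinuousOn (fun x ↦ -(C / ρ x * Q x)) Ω :=
    ((continuousOn_const.div hρ_cont.continuousOn fun x hx ↦ hx).mul (hexp _)).neg
  have hcw₂ : ContinuousOn (fun x ↦ a x * ρ x ^ (1 - C) * P x) Ω :=
    (ha_lip.continuousOn.mul (hρpow _).continuousOn).mul (hexp _)
  have hw₁ := AffineHardy.weakForm_nonneg_of_locLipschitzOn hΩo hcw₁ hbw₁ hρ_lip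
    (fun ψ hψ hψ0 ↦ AffineHardy.weakForm_nonneg_of_affineLaplacian hu hτ hρ_cont hρ_lip hρ_lap
      hψ hψ0) hη₁ hc₁ (hs₁.trans hφΩ) fun x ↦ by
        by_cases hx : ρ x = 0
        · have : φ x = 0 := image_eq_zero_of_notMem_tsupport fun h ↦ hφΩ h hx
          simp [this]
        · exact mul_nonneg (ha_nonneg x hx)
            (mul_nonneg (Real.rpow_nonneg (hρ_nonneg x) _) (mul_self_nonneg _))
  have hw₂ := AffineHardy.weakForm_nonneg_of_locLipschitzOn hΩo hcw₂ continuousOn_const hδ_lip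
    (fun ψ hψ hψ0 ↦ AffineHardy.weakForm_nonneg_of_affineDiv hu hτ hδ_div hψ hψ0)
    hη₂ hc₂ (hs₂.trans hφΩ) fun x ↦ by
        by_cases hx : ρ x = 0
        · have : φ x = 0 := image_eq_zero_of_notMem_tsupport fun h ↦ hφΩ h hx
          simp [this]
        · exact mul_nonneg (mul_nonneg (Real.rpow_nonneg (hρ_nonneg x) _)
            (inv_nonneg.2 (hδ_pos x hx).le)) (mul_self_nonneg _)
  have hi₁ := AffineHardy.integrable_weakForm hcw₁ hbw₁ hρ_lip hη₁ hc₁ (hs₁.trans hφΩ)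
  have hi₂ := AffineHardy.integrable_weakForm hcw₂ (continuousOn_const (c := (0 : ℝ))) hδ_lip
    hη₂ hc₂ (hs₂.trans hφΩ)
  rw [AffineHardy.weakForm] at hw₁ hw₂
  -- the integrands in terms of the Riemannian gradients
  have hPQ : ∀ x, P x = (Real.exp (u x) ^ (mu - lam)) ^ 2 * Q x := by
    intro x
    simp only [hP, hQ]
    rw [← Real.rpow_natCast, ← Real.rpow_mul (Real.exp_pos _).le, ← Real.rpow_add (Real.exp_pos _)]
    congr 1
    push_cast
    ring
  have hinner : ∀ (f h : M → ℝ) (x : M), inner ℝ (AffineHardy.affineGrad (n := n) lam mu u f x)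
      (AffineHardy.affineGrad lam mu u h x) = (Real.exp (u x) ^ (mu - lam)) ^ 2 *
        inner ℝ (AffineHardy.grad (n := n) f x) (AffineHardy.grad h x) := by
    intro f h x
    simp only [AffineHardy.affineGrad, inner_smul_left, inner_smul_right, conj_trivial]
    ring
  have hA : ∀ x, a x * ρ x ^ α * ‖AffineHardy.affineGrad (n := n) lam mu u φ x‖ ^ 2 *
      Real.exp (u x) ^ (τ + lam - mu) =
      a x * ρ x ^ α * P x *
        inner ℝ (AffineHardy.grad (n := n) φ x) (AffineHardy.grad φ x) := by
    intro x
    rw [← real_inner_self_eq_norm_sq, hinner, hPQ]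
    simp only [hQ]
    ring
  have hS : ∀ x, ρ x ^ (α - 1) * φ x ^ 2 * inner ℝ
      (AffineHardy.affineGrad (n := n) lam mu u a x) (AffineHardy.affineGrad lam mu u ρ x) *
      Real.exp (u x) ^ (τ + lam - mu) =
      ρ x ^ (α - 1) * φ x ^ 2 * P x *
        inner ℝ (AffineHardy.grad (n := n) a x) (AffineHardy.grad ρ x) := by
    intro x
    rw [hinner, hPQ]
    simp only [hQ]
    ring
  have hT : ∀ x, a x * ρ x ^ α * (‖AffineHardy.affineGrad (n := n) lam mu u δ x‖ ^ 2 / δ x ^ 2)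
      * φ x ^ 2 * Real.exp (u x) ^ (τ + lam - mu) = a x * ρ x ^ α * φ x ^ 2 / δ x ^ 2 * P x *
        inner ℝ (AffineHardy.grad (n := n) δ x) (AffineHardy.grad δ x) := by
    intro x
    rw [← real_inner_self_eq_norm_sq, hinner, hPQ]
    simp only [hQ]
    ring
  have hφ0 : ∀ x, x ∉ tsupport φ → φ x = 0 := fun x ↦ image_eq_zero_of_notMem_tsupport
  have hiA := AffineHardy.integrable_mul_inner_grad (n := n)
    ((ha_lip.continuousOn.mul (hρpow α).continuousOn).mul (hexp (τ + mu - lam))) hφl hφl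
    hφ.hasCompactSupport hφΩ
  have hiR := AffineHardy.integrable_of_continuousOn (n := n)
    (c := fun x ↦ a x * ρ x ^ (α - 2) * φ x ^ 2 * Q x)
    (((ha_lip.continuousOn.mul (hρpow (α - 2)).continuousOn).mul
      (hφl.continuousOn.pow 2)).mul (hexp _)) hφK hφΩ fun x hx ↦ by simp [hφ0 x hx]
  have hiS := AffineHardy.integrable_mul_of_support_subset (n := n)
    (c := fun x ↦ ρ x ^ (α - 1) * φ x ^ 2 * P x)
    (fun p hp ↦ AffineHardy.integrableAtFilter_inner_grad ha_lip hρ_lip hp)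
    (((hρpow (α - 1)).continuousOn.mul (hφl.continuousOn.pow 2)).mul (hexp _))
    hφK hφΩ fun x hx ↦ by simp [hφ0 x hx]
  have hiT := AffineHardy.integrable_mul_of_support_subset (n := n)
    (c := fun x ↦ a x * ρ x ^ α * φ x ^ 2 / δ x ^ 2 * P x)
    (fun p hp ↦ AffineHardy.integrableAtFilter_inner_grad hδ_lip hδ_lip hp)
    ((((ha_lip.continuousOn.mul (hρpow α).continuousOn).mul (hφl.continuousOn.pow 2)).div
      (hδ_lip.continuousOn.pow 2) fun x hx ↦ pow_ne_zero 2 (hδ_pos x hx).ne').mul (hexp _))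
    hφK hφΩ fun x hx ↦ by simp [hφ0 x hx]
  change Integrable (fun x ↦ a x * ρ x ^ α * P x *
    inner ℝ (AffineHardy.grad (n := n) φ x) (AffineHardy.grad φ x)) _ at hiA
  refine ⟨⟨hiA.congr (ae_of_all _ fun x ↦ (hA x).symm), hiR,
    hiS.congr (ae_of_all _ fun x ↦ (hS x).symm), hiT.congr (ae_of_all _ fun x ↦ (hT x).symm)⟩, ?_⟩
  simp only [hA, hS, hT]
  change β ^ 2 * ∫ x, a x * ρ x ^ (α - 2) * φ x ^ 2 * Q x ∂_ + _ + _ ≤ _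
  refine AffineHardy.hardy_integral (by rw [hβ]; linarith) hiA hiR hiS hiT hi₁ hi₂ hw₁ hw₂ ?_
  filter_upwards [hρ_grad, hρ_lip.ae_mdifferentiableAt, ha_lip.ae_mdifferentiableAt,
    hδ_lip.ae_mdifferentiableAt] with x hx1 hxρ hxa hxδ
  -- Off the support of `φ` every term vanishes. On it `ρ` and `δ` are positive, so the powers can
  -- be differentiated.
  by_cases hx : x ∈ tsupport φ
  swap
  · have h1 := AffineHardy.grad_eq_zero_of_notMem_tsupport (n := n) hx
    have h2 := AffineHardy.grad_eq_zero_of_notMem_tsupport (n := n) (fun h ↦ hx (hs₁ h))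
    have h3 := AffineHardy.grad_eq_zero_of_notMem_tsupport (n := n) (fun h ↦ hx (hs₂ h))
    simp [h1, h2, h3, hφ0 x hx]
  have hxΩ := hφΩ hx
  have hr := hρpos x hxΩ
  have hd := hδ_pos x hxΩ
  have hφd : MDifferentiableAt (𝓡 n) 𝓘(ℝ, ℝ) φ x := hφ.contMDiff.mdifferentiableAt (by simp)
  have g₁ := AffineHardy.grad_comp (hxρ hxΩ)
    (Real.hasDerivAt_rpow_const (p := α - 1) (Or.inl hr.ne'))
  have g₂ := AffineHardy.grad_comp (hxρ hxΩ)
    (Real.hasDerivAt_rpow_const (p := C + α - 1) (Or.inl hr.ne'))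
  have g₃ := AffineHardy.grad_comp (hxδ hxΩ) (hasDerivAt_inv hd.ne')
  have hφφd : MDifferentiableAt (𝓡 n) 𝓘(ℝ, ℝ) (fun x ↦ φ x * φ x) x := hφd.mul hφd
  have hd₁ : MDifferentiableAt (𝓡 n) 𝓘(ℝ, ℝ) (fun x ↦ ρ x ^ (α - 1) * (φ x * φ x)) x :=
    g₁.1.mul hφφd
  have hd₂ : MDifferentiableAt (𝓡 n) 𝓘(ℝ, ℝ) (fun x ↦ ρ x ^ (C + α - 1) * (δ x)⁻¹) x :=
    g₂.1.mul g₃.1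
  -- The normalisation `|∇^D ρ| = 1` in Riemannian terms. It lets the `|∇ρ|²` term of the square
  -- combine with the lower bound `(C/ρ) Q`.
  have hgQ : Q x = P x * inner ℝ (AffineHardy.grad (n := n) ρ x) (AffineHardy.grad ρ x) := by
    have h1 := hinner ρ ρ x
    rw [real_inner_self_eq_norm_sq, hx1 hxΩ, one_pow] at h1
    rw [hPQ, mul_right_comm, ← h1, one_mul]
  have key := AffineHardy.hardy_pointwise (φ := φ x) (AffineHardy.grad (n := n) φ x)
    (AffineHardy.grad ρ x) (AffineHardy.grad a x) (AffineHardy.grad δ x) (ha_nonneg x hxΩ) hr hd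
    (P := P x) (Real.rpow_nonneg (Real.exp_pos _).le _)
    (Real.rpow_nonneg hr.le (α - 2)) (Real.rpow_pos_of_pos hr (1 - C)) hgQ
    (m := ρ x ^ (C + α - 1)) (α := α) (C := C) (β := β) (by
      rw [← Real.rpow_add hr, ← Real.rpow_add_natCast hr.ne']
      congr 1
      push_cast
      ring) hβ
  have p₁ : ρ x ^ (α - 2) * ρ x ^ 2 = ρ x ^ α := by
    rw [← Real.rpow_add_natCast hr.ne']
    congr 1
    push_cast
    ring
  have p₂ : ρ x ^ (α - 2) * ρ x = ρ x ^ (α - 1) := by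
    rw [← Real.rpow_add_one hr.ne']
    congr 1
    ring
  have p₃ : ρ x ^ (C + α - 1) / ρ x = ρ x ^ (C + α - 1 - 1) := by
    exact (Real.rpow_sub_one hr.ne' _).symm
  have p₄ : α - 1 - 1 = α - 2 := by ring
  have p₅ : 2 * β = C + α - 1 := by rw [hβ]; ring
  rw [p₁, p₂, p₃, p₅] at key
  rw [AffineHardy.grad_mul (hxa hxΩ) hd₁, AffineHardy.grad_mul g₁.1 hφφd,
    AffineHardy.grad_mul hd₂ hφφd,
    AffineHardy.grad_mul g₂.1 g₃.1, AffineHardy.grad_mul hφd hφd, g₁.2, g₂.2, g₃.2, p₄]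
  refine key.trans_eq ?_
  ring
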